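/- Let $\Bbbk$ be an algebraically closed field of characteristic $p>0$ and let $X\to\mathbb P^1$ be a Harbater–Katz–Gabber cover over $\Bbbk$ whose Galois group $G$ is a $p$-group: it is totally ramified at one point $P\in X$ and unramified outside $P$. Let $F$ be the function field of $X$, let $g=\dim_{\Bbbk} H^0(X,\Omega_X)$, and suppose that $F$ is obtained from $F^{G}=\Bbbk(f_0)=F_1$ by a tower $$F_1\subset F_2\subset\dots\subset F_{k+1}=F,\qquad F_{i+1}=F_i(f_i)\quad(1\le i\le k),$$ of the following kind. The lower ramification groups $G_j=G_j(P)$ have the jumps $b_1<\dots<b_k$, all prime to $p$, with $G_{b_i}=\mathrm{Gal}(F/F_i)$ and $G_{b_i+1}=\mathrm{Gal}(F/F_{i+1})$; $P$ is the only pole of each $f_i$; the pole order at $P$ of $f_0$ is $|G_0|=p^{n_1+\dots+n_k}$ and that of $f_i$, $i\ge1$, is $\bar m_i=p^{n_{i+1}+\dots+n_k}b_i$; and the irreducible polynomial of $f_i$ over $F_i$ is $$X^{p^{n_i}}+a^{(i)}_{n_i-1}X^{p^{n_i-1}}+\dots+a^{(i)}_0X-D_i,\qquad D_i=\sum_{\bar\lambda\in\Lambda_i}a^{(i)}_{\bar\lambda}f_{\bar\lambda}\in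 F_i,$$ with $n_i\ge1$ and coefficients $a^{(i)}_j,a^{(i)}_{\bar\lambda}\in\Bbbk$, almost all $a^{(i)}_{\bar\lambda}$ being zero. Here $f_u=f_0^{u_0}\cdots f_k^{u_k}$ for $u\in\mathbb N^{k+1}$, and $\Lambda_i$ is the set of all $\bar\lambda=(\ell_0,\dots,\ell_{i-1},0,\dots,0)\in\mathbb N^{k+1}$ with $\ell_\nu<p^{n_\nu}$ for $1\le\nu\le i-1$. Put $\|u\|=u_0|G_0|+\sum_{\nu=1}^k u_\nu\bar m_\nu$ and $\mathbf A=\{L\in\mathbb N^{k+1}:\|L\|\le 2g-2\}$. Let $\phi:\mathrm{Sym}\,H^0(X,\Omega_X)\to\bigoplus_{n\ge0}H^0(X,\Omega_X^{\otimes n})$ be the canonical map; the canonical ideal is $\ker\phi$. A representative of $f_u\,df_0^{\otimes2}$ is an element $\omega_u^{\otimes2}$ of degree $2$ of $\mathrm{Sym}\,H^0(X,\Omega_X)$ with $\phi(\omega_u^{\otimes 2})=f_u\,df_0^{\otimes2}$. Then $\omega_L:=f_L\,df_0$ is a holomorphic differential for each $L\in\mathbf A$, and for $L,K\in\mathbf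 A$ the product $\omega_L\omega_K$ is a representative of $f_{L+K}\,df_0^{\otimes2}$. Moreover, let $1\le i\le k$ and let $\bar v\in\mathbb N^{k+1}$; for $0\le\nu\le n_i$ let $\bar\gamma_{\bar v,i,\nu}$ be obtained from $\bar v$ by adding $p^{n_i-\nu}$ to the entry $v_i$, and put $\bar\beta_{\bar v,i,\bar\lambda}=\bar\lambda+\bar v$. Suppose that $\|\bar\gamma_{\bar v,i,0}\|\le4g-4$. Then: 1. each $u$ among the $\bar\gamma_{\bar v,i,\nu}$, $0\le\nu\le n_i$, and the $\bar\beta_{\bar v,i,\bar\lambda}$, where $\bar\lambda\in\Lambda_i$, $a^{(i)}_{\bar\lambda}\ne0$ and $\|\bar\lambda\|\le p^{n_i}\bar m_i$, satisfies $\|u\|\le4g-4$, and $f_u\,df_0^{\otimes2}$ is a holomorphic quadratic differential; 2. for every choice of representatives $\omega_u^{\otimes2}$ of the quadratic differentials $f_u\,df_0^{\otimes2}$ for these $u$, the element $$G_{\bar v,i}=\omega_{\bar\gamma_{\bar v,i,0}}^{\otimes2}+\sum_{\nu=1}^{n_i}a^{(i)}_{n_i-\nu}\,\omega_{\bar\gamma_{\bar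 v,i,\nu}}^{\otimes2}-\sum_{\bar\lambda\in\Lambda_i,\ \|\bar\lambda\|\le p^{n_i}\bar m_i}a^{(i)}_{\bar\lambda}\,\omega_{\bar\beta_{\bar v,i,\bar\lambda}}^{\otimes2}$$ is homogeneous of degree $2$ and lies in the canonical ideal. -/

import Mathlib

open scoped IntermediateField

noncomputable section

namespace HKG

section Curve

variable (𝕜 : Type*) {F : Type*} [Field 𝕜] [Field F] [Algebra 𝕜 F]

/-- The closed points of the complete nonsingular curve over the algebraically closed field `𝕜`
with function field `F` are the nontrivial valuation rings of `F` that contain `𝕜`. -/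
structure IsPlace (O : ValuationSubring F) : Prop where
  contains_constants : ∀ c : 𝕜, algebraMap 𝕜 F c ∈ O
  ne_top : O ≠ ⊤

/-- `t` generates the maximal ideal of the valuation ring `O`. -/
def IsUniformizer (O : ValuationSubring F) (t : O) : Prop :=
  IsLocalRing.maximalIdeal O = Ideal.span {t}

/-- `x` has a pole of order exactly `m` at `O` : `x * t ^ m` is a unit of `O` for some
uniformizer `t`. -/
def HasPoleOrder (O : ValuationSubring F) (x : F) (m : ℕ) : Prop :=
  ∃ t : O, IsUniformizer O t ∧ ∃ w : Oˣ, x * (t : F) ^ m = ((w : O) : F)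

/-- The `j`-th ramification group, in the lower numbering, of the place `O` of `F` over the
subfield `E` : the automorphisms that act trivially on `O / 𝔪 ^ (j + 1)`.
For `j = 0` this is the inertia group. -/
def ramificationGroup (E : Type*) [Field E] [Algebra E F] (O : ValuationSubring F) (j : ℕ) :
    Set (F ≃ₐ[E] F) :=
  {σ | ∀ x : O, ∃ y ∈ IsLocalRing.maximalIdeal O ^ (j + 1), σ (x : F) - (x : F) = ((y : O) : F)}

/-- A Harbater-Katz-Gabber cover with group a `p`-group: `F` is a finite Galois extension of the
rational function field `𝕜(x)` whose group is a `p`-group, totally ramified at the place `P`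
and unramified at all the other places (the residue fields are all equal to the algebraically
closed field `𝕜`, so that ramification is read off from the inertia groups). -/
structure IsHKGCover (p : ℕ) (x : F) (P : ValuationSubring F) : Prop where
  transcendental : Transcendental 𝕜 x
  finite : FiniteDimensional 𝕜⟮x⟯ F
  galois : IsGalois 𝕜⟮x⟯ F
  isPGroup : IsPGroup p (F ≃ₐ[𝕜⟮x⟯] F)
  place : IsPlace 𝕜 P
  totally_ramified : ramificationGroup 𝕜⟮x⟯ P 0 = Set.univ
  unramified : ∀ Q : ValuationSubring F, IsPlace 𝕜 Q → Q ≠ P → ramificationGroup 𝕜⟮x⟯ Q 0 = {1}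

variable (F)

/-- The algebra `⨁ₙ Ω^{⊗ n}` of meromorphic polydifferentials. The space `Ω` of meromorphic
differentials is one-dimensional over `F`, so that `Ω^{⊗ n}` is its `n`-th symmetric power. -/
abbrev PolyDiff : Type _ := SymmetricAlgebra F (Ω[F⁄𝕜])

variable {F} in
/-- The differential `dx`, as a polydifferential of degree one. -/
def dd (x : F) : PolyDiff 𝕜 F := SymmetricAlgebra.ι F (Ω[F⁄𝕜]) (KaehlerDifferential.D 𝕜 F x)

/-- `H⁰(X, Ω)` : the differentials that are regular at each place `O`, that is, that
belong to the `O`-module generated by the `dx` with `x ∈ O`. -/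
def holomorphicDifferentials : Submodule 𝕜 (Ω[F⁄𝕜]) :=
  ⨅ (O : ValuationSubring F) (_ : IsPlace 𝕜 O),
    Submodule.span 𝕜 {ω | ∃ a ∈ O, ∃ x ∈ O, ω = a • KaehlerDifferential.D 𝕜 F x}

/-- `H⁰(X, Ω^{⊗ 2})` : the quadratic differentials that are regular at each place `O`, that is,
that belong to the `O`-module generated by the `dx dy` with `x, y ∈ O`. -/
def holomorphicQuadraticDifferentials : Submodule 𝕜 (PolyDiff 𝕜 F) :=
  ⨅ (O : ValuationSubring F) (_ : IsPlace 𝕜 O),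
    Submodule.span 𝕜 {q | ∃ a ∈ O, ∃ x ∈ O, ∃ y ∈ O, q = a • (dd 𝕜 x * dd 𝕜 y)}

/-- The genus `g = dim H⁰(X, Ω)`. -/
def genus : ℕ := Module.finrank 𝕜 (holomorphicDifferentials 𝕜 F)

/-- `Sym H⁰(X, Ω)`. -/
abbrev SymH : Type _ := SymmetricAlgebra 𝕜 (holomorphicDifferentials 𝕜 F)

/-- The canonical map `φ` from `Sym H⁰(X, Ω)` to the polydifferentials, which multiplies
differentials. -/
def canonicalMap : SymH 𝕜 F →ₐ[𝕜] PolyDiff 𝕜 F :=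
  SymmetricAlgebra.lift
    (((SymmetricAlgebra.ι F (Ω[F⁄𝕜])).restrictScalars 𝕜).comp
      (holomorphicDifferentials 𝕜 F).subtype)

/-- The canonical ideal: the kernel of the canonical map. -/
def canonicalIdeal : Ideal (SymH 𝕜 F) := RingHom.ker (canonicalMap 𝕜 F)

/-- The homogeneous part of degree two of `Sym H⁰(X, Ω)`. -/
def Sym2H : Submodule 𝕜 (SymH 𝕜 F) :=
  LinearMap.range (SymmetricAlgebra.ι 𝕜 (holomorphicDifferentials 𝕜 F)) ^ 2

end Curve

/-- The monomial `f₀ ^ u₀ ⋯ f_k ^ u_k`. -/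
def monom {k : ℕ} {F : Type*} [Field F] (f : Fin (k + 1) → F) (u : Fin (k + 1) → ℕ) : F :=
  ∏ j, f j ^ u j

/-- The weights `|G₀| = p ^ (n₁ + ⋯ + n_k)` and `m̄ᵢ = p ^ (nᵢ₊₁ + ⋯ + n_k) * bᵢ`. A step
`1 ≤ i ≤ k` of the tower is an element of `Fin k`, and its generator `fᵢ` has the index `i.succ`
among the `k + 1` generators `f₀, …, f_k`. -/
def weight (p : ℕ) {k : ℕ} (n b : Fin k → ℕ) : Fin (k + 1) → ℕ :=
  Fin.cases (p ^ ∑ j, n j) fun i => p ^ (∑ j ∈ Finset.Ioi i, n j) * b i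

/-- `‖u‖ = u₀ |G₀| + ∑ᵢ uᵢ m̄ᵢ`. -/
def wnorm (p : ℕ) {k : ℕ} (n b : Fin k → ℕ) (u : Fin (k + 1) → ℕ) : ℕ :=
  ∑ j, u j * weight p n b j

/-- The exponents `(ℓ₀, …, ℓᵢ₋₁, 0, …, 0)` with `ℓ_ν < p ^ n_ν` for `1 ≤ ν ≤ i - 1`. -/
def reducedExponents (p : ℕ) {k : ℕ} (n : Fin k → ℕ) (i : Fin k) : Set (Fin (k + 1) → ℕ) :=
  {l | (∀ j, i.succ ≤ j → l j = 0) ∧ ∀ ν : Fin k, ν < i → l ν.succ < p ^ n ν}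

/-- The field `Fᵢ = 𝕜(f₀, …, fᵢ₋₁)`. -/
def stepField (𝕜 : Type*) {F : Type*} [Field 𝕜] [Field F] [Algebra 𝕜 F] {k : ℕ}
    (f : Fin (k + 1) → F) (i : Fin k) : IntermediateField 𝕜 F :=
  IntermediateField.adjoin 𝕜 (f '' {j | j < i.succ})

open Polynomial in
/-- The polynomial `X ^ (p ^ n) + ∑_{j < n} a_j X ^ (p ^ j) - D` with `D = ∑_λ d_λ f ^ λ`. -/
def stepPolynomial (p : ℕ) {𝕜 F : Type*} [Field 𝕜] [Field F] [Algebra 𝕜 F] {k : ℕ}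
    (f : Fin (k + 1) → F) (n : ℕ) (a : ℕ → 𝕜) (d : (Fin (k + 1) → ℕ) →₀ 𝕜) : F[X] :=
  X ^ p ^ n + ∑ j ∈ Finset.range n, C (algebraMap 𝕜 F (a j)) * X ^ p ^ j
    - C (∑ l ∈ d.support, algebraMap 𝕜 F (d l) * monom f l)

/-- A Harbater-Katz-Gabber cover with group a `p`-group, together with the tower
`𝕜(f₀) = F₁ ⊂ F₂ ⊂ ⋯ ⊂ F_{k+1} = F`, `Fᵢ₊₁ = Fᵢ(fᵢ)`, of the fixed fields of the ramification
groups, and the additive polynomial equations satisfied by its generators. -/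
structure Tower (p k : ℕ) (𝕜 F : Type*) [Field 𝕜] [Field F] [Algebra 𝕜 F] where
  /-- the ramified place -/
  P : ValuationSubring F
  /-- the generators `f₀, …, f_k` -/
  f : Fin (k + 1) → F
  /-- the step `i` has degree `p ^ n i` -/
  n : Fin k → ℕ
  /-- the jumps of the ramification filtration -/
  b : Fin k → ℕ
  /-- `a i j` is the coefficient of `X ^ (p ^ j)`, `0 ≤ j < n i`, in the equation of `fᵢ` -/
  a : Fin k → ℕ → 𝕜
  /-- `d i` is the family of the coefficients of `Dᵢ` as a polynomial in `f₀, …, fᵢ₋₁` -/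
  d : Fin k → ((Fin (k + 1) → ℕ) →₀ 𝕜)
  cover : IsHKGCover 𝕜 p (f 0) P
  generate : IntermediateField.adjoin 𝕜 (Set.range f) = ⊤
  n_pos : ∀ i, 0 < n i
  b_strictMono : StrictMono b
  b_coprime : ∀ i, Nat.Coprime (b i) p
  /-- `G_{bᵢ}` is the group of `F` over `Fᵢ = 𝕜(f₀, …, fᵢ₋₁)` -/
  jump : ∀ i, ramificationGroup 𝕜⟮f 0⟯ P (b i) = {σ | ∀ j, j < i.succ → σ (f j) = f j}
  /-- `G_{bᵢ + 1}` is the group of `F` over `Fᵢ₊₁` -/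
  jump_succ : ∀ i, ramificationGroup 𝕜⟮f 0⟯ P (b i + 1) = {σ | ∀ j, j ≤ i.succ → σ (f j) = f j}
  /-- `P` is the only pole of each generator -/
  regular : ∀ j (Q : ValuationSubring F), IsPlace 𝕜 Q → Q ≠ P → f j ∈ Q
  /-- `f₀` has a pole of order `|G₀|`, and `fᵢ` one of order `m̄ᵢ`, at `P` -/
  pole : ∀ j, HasPoleOrder P (f j) (weight p n b j)
  d_reduced : ∀ i, ∀ l ∈ (d i).support, l ∈ reducedExponents p n i
  /-- the irreducible polynomial of `fᵢ` over `Fᵢ` -/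
  equation : ∀ i, (minpoly (stepField 𝕜 f i) (f i.succ)).map (algebraMap (stepField 𝕜 f i) F) =
    stepPolynomial p f (n i) (a i) (d i)

namespace Tower

variable {p k : ℕ} {𝕜 F : Type*} [Field 𝕜] [Field F] [Algebra 𝕜 F] (T : Tower p k 𝕜 F)

/-- `‖u‖`. -/
def nrm (u : Fin (k + 1) → ℕ) : ℕ := wnorm p T.n T.b u

/-- The set `𝐀` of the exponents `L` with `‖L‖ ≤ 2 g - 2` (in `ℤ`). -/
def A : Set (Fin (k + 1) → ℕ) := {L | T.nrm L + 2 ≤ 2 * genus 𝕜 F}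

/-- The differential `f_L df₀`. -/
def diff (L : Fin (k + 1) → ℕ) : Ω[F⁄𝕜] :=
  monom T.f L • KaehlerDifferential.D 𝕜 F (T.f 0)

/-- The quadratic differential `f_u df₀^{⊗ 2}`. -/
def quadDiff (u : Fin (k + 1) → ℕ) : PolyDiff 𝕜 F := monom T.f u • dd 𝕜 (T.f 0) ^ 2

/-- `q` is an element of degree two of `Sym H⁰(X, Ω)` that represents the quadratic differential
`f_u df₀^{⊗ 2}`. -/
def Represents (u : Fin (k + 1) → ℕ) (q : SymH 𝕜 F) : Prop :=
  q ∈ Sym2H 𝕜 F ∧ canonicalMap 𝕜 F q = T.quadDiff u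

/-- `γ_{v,i,ν} = (v₀, …, vᵢ + p ^ (nᵢ - ν), …, v_k)`, for `0 ≤ ν ≤ nᵢ`. -/
def gamma (v : Fin (k + 1) → ℕ) (i : Fin k) (ν : ℕ) : Fin (k + 1) → ℕ :=
  v + Pi.single i.succ (p ^ (T.n i - ν))

/-- `β_{v,λ} = λ + v`. -/
def beta (v l : Fin (k + 1) → ℕ) : Fin (k + 1) → ℕ := l + v

/-- The exponents `λ ∈ Λᵢ` of the monomials of `Dᵢ` with `‖λ‖ ≤ p ^ nᵢ m̄ᵢ`. -/
def lambdas (i : Fin k) : Finset (Fin (k + 1) → ℕ) :=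
  (T.d i).support.filter fun l => T.nrm l ≤ p ^ T.n i * weight p T.n T.b i.succ

/-- The exponents of all the terms of `G_{v,i}`. -/
def terms (v : Fin (k + 1) → ℕ) (i : Fin k) : Set (Fin (k + 1) → ℕ) :=
  {u | (∃ ν ≤ T.n i, u = T.gamma v i ν) ∨ ∃ l ∈ T.lambdas i, u = beta v l}

/-- The element `G_{v,i}`, for a choice `W u` of a representative `ω_u^{⊗ 2}` of each quadratic
differential `f_u df₀^{⊗ 2}`. The coefficient of `ω^{⊗ 2}_{γ_{v,i,ν}}` is that of
`X ^ (p ^ (nᵢ - ν))` in the additive polynomial. -/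
def G (v : Fin (k + 1) → ℕ) (i : Fin k) (W : (Fin (k + 1) → ℕ) → SymH 𝕜 F) : SymH 𝕜 F :=
  W (T.gamma v i 0) + ∑ ν ∈ Finset.Icc 1 (T.n i), T.a i (T.n i - ν) • W (T.gamma v i ν)
    - ∑ l ∈ T.lambdas i, T.d i l • W (beta v l)

end Tower

end HKG

end

/-! Multiplying the equation of `fᵢ` by `f_v df₀²` gives a linear relation between the quadratic
differentials `f_u df₀²` whose exponents are the terms of `G_{v,i}`. Since the canonical map is
linear, `G_{v,i}` is sent to that relation whatever representatives are chosen
(`canonicalMap_G_eq_zero`). The substance lies in holomorphy: a bound on `‖u‖` in terms of the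
genus, defined as `dim H⁰(X, Ω)`, must bound the poles.

Put `N = ∑ (p ^ nᵢ - 1) m̄ᵢ - |G₀|` (`frobeniusNumber`). A local computation with the derivation
`d/df₀` shows that `df₀` has a zero of order `N - 1` at `P`. Indeed `aᵢ₀ dfᵢ = dDᵢ`, and the leading
monomial of `Dᵢ` contains the preceding generator with an exponent prime to `p`. So the order of
`dfᵢ/df₀` is found recursively, and the logarithmic derivatives have strictly increasing pole
orders. Hence `f_L df₀` is holomorphic when `‖L‖ ≤ N - 1`, and `f_u df₀²` when `‖u‖ ≤ 2 (N - 1)`. It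
remains to prove `2g - 2 ≤ N - 1` for `g > 0` (`genus_le`); no Riemann–Roch or Hurwitz formula is
needed.

For this, write a holomorphic differential as `h df₀`. The same computation gives `aᵢ₀ ≠ 0`, so each
step of the tower is étale over the affine part and `𝕜[f₀, …, f_k]` is normal. Therefore it contains
every function regular outside `P`, in particular `h`. Reduced monomials span this ring and have
distinct pole orders at `P`, so `h` is a combination of reduced `f_L` with `‖L‖ < N`. Finally, `m`
and `N - m` are never both norms of reduced exponents, so there are at most `(N + 1) / 2` such `L`
once one exists. -/

noncomputable section

namespace HKG

/-! ### Arithmetic of the weights and of the norms of reduced exponents. -/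

section Arithmetic

variable {p k : ℕ} {n b : Fin k → ℕ}

@[simp] lemma weight_zero : weight p n b 0 = p ^ ∑ j, n j := rfl

@[simp] lemma weight_succ (i : Fin k) :
    weight p n b i.succ = p ^ (∑ j ∈ Finset.Ioi i, n j) * b i := rfl

lemma weight_pos (hp : p.Prime) (hb : ∀ i, (b i).Coprime p) (j : Fin (k + 1)) :
    0 < weight p n b j := by
  induction j using Fin.cases with
  | zero => exact pow_pos hp.pos _
  | succ i =>
    refine Nat.mul_pos (pow_pos hp.pos _) (Nat.pos_of_ne_zero fun h => ?_)
    have := hb i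
    rw [h, Nat.coprime_zero_left] at this
    exact hp.one_lt.ne' this

lemma wnorm_add (u v : Fin (k + 1) → ℕ) :
    wnorm p n b (u + v) = wnorm p n b u + wnorm p n b v := by
  simp [wnorm, add_mul, Finset.sum_add_distrib]

lemma wnorm_single (j : Fin (k + 1)) (e : ℕ) :
    wnorm p n b (Pi.single j e) = e * weight p n b j := by
  rw [wnorm, Finset.sum_eq_single j]
  · simp
  · intro l _ hl
    simp [hl]
  · simp

lemma sum_Ici_eq (i : Fin k) :
    ∑ j ∈ Finset.Ici i, n j = n i + ∑ j ∈ Finset.Ioi i, n j := by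
  rw [← Finset.Ioi_insert, Finset.sum_insert (by simp)]

/-- The weights below the generator of the step `i` are divisible by the degree of `F / Fᵢ`. -/
lemma pow_sum_Ici_dvd_weight (i : Fin k) {j : Fin (k + 1)} (hj : j < i.succ) :
    p ^ (∑ l ∈ Finset.Ici i, n l) ∣ weight p n b j := by
  induction j using Fin.cases with
  | zero => exact pow_dvd_pow _ (Finset.sum_le_univ_sum_of_nonneg fun _ => Nat.zero_le _)
  | succ m =>
    refine Dvd.dvd.mul_right (pow_dvd_pow _ (Finset.sum_le_sum_of_subset fun l hl => ?_)) _
    rw [Finset.mem_Ici] at hl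
    rw [Finset.mem_Ioi]
    exact lt_of_lt_of_le (Fin.succ_lt_succ_iff.mp hj) hl

lemma pow_sum_Ici_succ_dvd_weight (hn : ∀ i, 0 < n i) (i : Fin k) {j : Fin (k + 1)}
    (hj : j < i.castSucc) :
    p ^ (∑ l ∈ Finset.Ici i, n l + 1) ∣ weight p n b j := by
  obtain ⟨m, hm⟩ : ∃ m : Fin k, m.succ = i.castSucc :=
    Fin.exists_succ_eq.mpr (ne_of_gt (lt_of_le_of_lt (Fin.zero_le j) hj))
  have hmi : m < i := by
    rw [← Fin.castSucc_lt_castSucc_iff, ← hm]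
    exact Fin.castSucc_lt_succ
  refine dvd_trans (pow_dvd_pow _ ?_) (pow_sum_Ici_dvd_weight m (hm ▸ hj))
  rw [sum_Ici_eq m, add_comm]
  refine add_le_add (hn m) (Finset.sum_le_sum_of_subset fun l hl => ?_)
  rw [Finset.mem_Ici] at hl
  rw [Finset.mem_Ioi]
  exact lt_of_lt_of_le hmi hl

/-- An integral relation between the weights whose coefficients, except the first, are small
is trivial. -/
lemma eq_zero_of_sum_weight_eq_zero (hp : p.Prime) (hb : ∀ i, (b i).Coprime p)
    (u : Fin (k + 1) → ℤ) (hu : ∀ i : Fin k, |u i.succ| < (p : ℤ) ^ n i)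
    (h : ∑ j, u j * (weight p n b j : ℤ) = 0) : u = 0 := by
  have hp0 : (p : ℤ) ≠ 0 := by exact_mod_cast hp.ne_zero
  have hs : ∀ i : Fin k, u i.succ = 0 := by
    intro i
    induction i using WellFoundedGT.induction with
    | ind i ih =>
      -- Descending induction on `i`: the later coefficients already vanish and the earlier weights
      -- are divisible by `p ^ (nᵢ + ⋯ + n_k)`. As `bᵢ` is prime to `p`, this forces `p ^ nᵢ ∣ uᵢ`,
      -- and `uᵢ` is too small to be nonzero.
      have hdvd : ((p : ℤ) ^ ∑ l ∈ Finset.Ici i, n l) ∣ u i.succ * (weight p n b i.succ : ℤ) := by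
        rw [← Finset.add_sum_erase _ _ (Finset.mem_univ i.succ)] at h
        rw [eq_neg_of_add_eq_zero_left h, dvd_neg]
        refine Finset.dvd_sum fun j hj => ?_
        rcases lt_or_gt_of_ne (Finset.ne_of_mem_erase hj) with hji | hji
        · exact Dvd.dvd.mul_left (by exact_mod_cast pow_sum_Ici_dvd_weight i hji) _
        · obtain ⟨m, rfl⟩ := Fin.exists_succ_eq.mpr
            (ne_of_gt (lt_of_le_of_lt (Fin.zero_le i.succ) hji))
          rw [ih m (Fin.succ_lt_succ_iff.mp hji), zero_mul]
          exact dvd_zero _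
      rw [sum_Ici_eq, weight_succ, add_comm, pow_add] at hdvd
      push_cast at hdvd
      rw [mul_left_comm] at hdvd
      have h1 := (mul_dvd_mul_iff_left (pow_ne_zero _ hp0)).mp hdvd
      have hcop : IsCoprime ((p : ℤ) ^ n i) (b i : ℤ) :=
        (Nat.isCoprime_iff_coprime.mpr (hb i).symm).pow_left
      exact Int.eq_zero_of_abs_lt_dvd (hcop.dvd_of_dvd_mul_right h1) (hu i)
  funext j
  induction j using Fin.cases with
  | succ i => exact hs i
  | zero =>
    rw [Fin.sum_univ_succ] at h
    simp only [hs, zero_mul, Finset.sum_const_zero, add_zero, weight_zero] at h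
    push_cast at h
    exact (mul_eq_zero.mp h).resolve_right (pow_ne_zero _ hp0)

/-- The exponents that are reduced with respect to all the generators `f₁, …, f_k`. -/
def Reduced (p : ℕ) {k : ℕ} (n : Fin k → ℕ) (L : Fin (k + 1) → ℕ) : Prop :=
  ∀ i : Fin k, L i.succ < p ^ n i

lemma reduced_of_mem_reducedExponents (hp : 0 < p) {i : Fin k} {l : Fin (k + 1) → ℕ}
    (hl : l ∈ reducedExponents p n i) : Reduced p n l := by
  intro m
  rcases lt_or_ge m i with h | h
  · exact hl.2 m h
  · rw [hl.1 _ (Fin.succ_le_succ_iff.mpr h)]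
    exact pow_pos hp _

lemma wnorm_injOn (hp : p.Prime) (hb : ∀ i, (b i).Coprime p) :
    Set.InjOn (wnorm p n b) {L | Reduced p n L} := by
  intro L hL K hK h
  have h0 := eq_zero_of_sum_weight_eq_zero (n := n) hp hb (fun j => (L j : ℤ) - K j) (fun i => by
    have h1 : (L i.succ : ℤ) < (p : ℤ) ^ n i := by exact_mod_cast hL i
    have h2 : (K i.succ : ℤ) < (p : ℤ) ^ n i := by exact_mod_cast hK i
    rw [abs_lt]; constructor <;> linarith) (by
    have h' : ((wnorm p n b L : ℕ) : ℤ) = (wnorm p n b K : ℕ) := by rw [h]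
    simp only [wnorm, Nat.cast_sum, Nat.cast_mul] at h'
    simp only [sub_mul, Finset.sum_sub_distrib, h', sub_self])
  funext j
  have := congrFun h0 j
  simp only [Pi.zero_apply] at this
  omega

/-- The largest integer that is not the norm of a reduced exponent: the Frobenius number of the
semigroup of the pole orders at `P`. -/
def frobeniusNumber (p : ℕ) {k : ℕ} (n b : Fin k → ℕ) : ℤ :=
  ∑ i : Fin k, ((p : ℤ) ^ n i - 1) * weight p n b i.succ - weight p n b 0

/-- An equality would be a relation between the weights with coefficients `Lᵢ + Kᵢ - (p ^ nᵢ - 1)`,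
smaller than `p ^ nᵢ` in absolute value, and first coefficient `L₀ + K₀ + 1`. That coefficient would
have to vanish, yet it is positive. This is the half of the symmetry of the semigroup that bounds
the genus from above. -/
lemma wnorm_add_wnorm_ne_frobeniusNumber (hp : p.Prime) (hb : ∀ i, (b i).Coprime p)
    {L K : Fin (k + 1) → ℕ} (hL : Reduced p n L) (hK : Reduced p n K) :
    (wnorm p n b L : ℤ) + wnorm p n b K ≠ frobeniusNumber p n b := by
  intro h
  have hp1 : 1 < (p : ℤ) := by exact_mod_cast hp.one_lt
  have h0 := eq_zero_of_sum_weight_eq_zero (n := n) hp hb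
    (Fin.cases ((L 0 : ℤ) + K 0 + 1) fun i => (L i.succ : ℤ) + K i.succ - ((p : ℤ) ^ n i - 1))
    (fun i => by
      have h1 : (L i.succ : ℤ) < (p : ℤ) ^ n i := by exact_mod_cast hL i
      have h2 : (K i.succ : ℤ) < (p : ℤ) ^ n i := by exact_mod_cast hK i
      simp only [Fin.cases_succ]
      rw [abs_lt]
      constructor <;> linarith [Int.natCast_nonneg (L i.succ), Int.natCast_nonneg (K i.succ)])
    (by
      simp only [wnorm, frobeniusNumber, Fin.sum_univ_succ, Nat.cast_add, Nat.cast_sum,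
        Nat.cast_mul] at h
      rw [Fin.sum_univ_succ]
      simp only [Fin.cases_zero, Fin.cases_succ]
      simp only [sub_mul, add_mul, one_mul, Finset.sum_sub_distrib, Finset.sum_add_distrib]
        at h ⊢
      linarith)
  have := congrFun h0 0
  simp only [Fin.cases_zero, Pi.zero_apply] at this
  omega

/-- At most half of the integers below the Frobenius number are norms. -/
lemma exists_finset_reduced (hp : p.Prime) (hb : ∀ i, (b i).Coprime p) :
    ∃ E : Finset (Fin (k + 1) → ℕ),
      (∀ L, L ∈ E ↔ Reduced p n L ∧ (wnorm p n b L : ℤ) < frobeniusNumber p n b) ∧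
      (E.card = 0 ∨ 2 * (E.card : ℤ) ≤ frobeniusNumber p n b + 1) := by
  set N := frobeniusNumber p n b with hN
  have hfin : {L | Reduced p n L ∧ (wnorm p n b L : ℤ) < N}.Finite := by
    refine Set.Finite.of_finite_image (f := wnorm p n b)
      ((Set.finite_lt_nat N.toNat).subset ?_) ((wnorm_injOn hp hb).mono fun L hL => hL.1)
    rintro _ ⟨L, hL, rfl⟩
    have := hL.2
    simp only [Set.mem_ofPred_eq]
    omega
  refine ⟨hfin.toFinset, fun L => by simp, ?_⟩
  set E := hfin.toFinset with hE
  have hmem : ∀ L ∈ E, Reduced p n L ∧ (wnorm p n b L : ℤ) < N := fun L hL => by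
    simpa [hE] using hL
  -- The empty case is kept apart so that no lower bound on `N` is needed. Otherwise `N > 0`, and
  -- the norms and their reflections `N - ‖L‖` are disjoint sets among the `N + 1` integers of `[0,
  -- N]`.
  rcases Finset.eq_empty_or_nonempty E with h0 | ⟨L0, hL0⟩
  · exact Or.inl (by rw [h0, Finset.card_empty])
  right
  have hNpos : 0 < N := lt_of_le_of_lt (Int.natCast_nonneg _) (hmem L0 hL0).2
  have hinj : Set.InjOn (fun L => (wnorm p n b L : ℤ)) (E : Set (Fin (k + 1) → ℕ)) :=
    fun L hL K hK h => wnorm_injOn hp hb (hmem L hL).1 (hmem K hK).1 (by simpa using h)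
  set S := E.image fun L => (wnorm p n b L : ℤ) with hS
  set S' := E.image fun L => N - (wnorm p n b L : ℤ) with hS'
  have hc : S.card = E.card := Finset.card_image_of_injOn hinj
  have hc' : S'.card = E.card :=
    Finset.card_image_of_injOn fun L hL K hK h => hinj hL hK (by simpa using h)
  have hdisj : Disjoint S S' := by
    rw [Finset.disjoint_left]
    intro z hz hz'
    obtain ⟨L, hL, rfl⟩ := Finset.mem_image.mp hz
    obtain ⟨K, hK, h⟩ := Finset.mem_image.mp hz'
    refine wnorm_add_wnorm_ne_frobeniusNumber hp hb (hmem L hL).1 (hmem K hK).1 ?_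
    rw [← hN]
    linarith
  have hsub : S ∪ S' ⊆ Finset.Icc 0 N := by
    intro z hz
    rw [Finset.mem_Icc]
    rcases Finset.mem_union.mp hz with hz | hz
    · obtain ⟨L, hL, rfl⟩ := Finset.mem_image.mp hz
      exact ⟨Int.natCast_nonneg _, (hmem L hL).2.le⟩
    · obtain ⟨L, hL, rfl⟩ := Finset.mem_image.mp hz
      have := (hmem L hL).2
      constructor <;> omega
  have := Finset.card_le_card hsub
  rw [Finset.card_union_of_disjoint hdisj, hc, hc', Int.card_Icc] at this
  omega

/-- The leading exponent of `Dᵢ` is prime to `p` in its last entry. -/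
lemma not_dvd_of_wnorm_eq (hp : p.Prime) (hn : ∀ i, 0 < n i) (hb : ∀ i, (b i).Coprime p)
    {i : Fin k} {l : Fin (k + 1) → ℕ} (hl : l ∈ reducedExponents p n i)
    (h : wnorm p n b l = p ^ n i * weight p n b i.succ) : ¬ p ∣ l i.castSucc := by
  intro hdvd
  have h1 : p ^ (∑ m ∈ Finset.Ici i, n m + 1) ∣ wnorm p n b l := by
    -- The weights of index below `i.castSucc` carry a spare factor `p`, and the entries above it
    -- vanish. If `p` divided the entry at `i.castSucc`, the norm would be divisible by one more
    -- power of `p` than `p ^ (nᵢ + ⋯ + n_k) bᵢ` is.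
    refine Finset.dvd_sum fun j _ => ?_
    rcases lt_trichotomy j i.castSucc with hj | rfl | hj
    · exact Dvd.dvd.mul_left (pow_sum_Ici_succ_dvd_weight hn i hj) _
    · rw [pow_succ, mul_comm]
      exact mul_dvd_mul hdvd (pow_sum_Ici_dvd_weight i Fin.castSucc_lt_succ)
    · rw [hl.1 j (Fin.castSucc_lt_iff_succ_le.mp hj), zero_mul]
      exact dvd_zero _
  rw [h, weight_succ, ← mul_assoc, ← pow_add, ← sum_Ici_eq, pow_succ] at h1
  have h2 := (Nat.mul_dvd_mul_iff_left (pow_pos hp.pos _)).mp h1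
  have h3 := Nat.dvd_gcd h2 (dvd_refl p)
  rw [hb i] at h3
  exact hp.one_lt.ne' (Nat.dvd_one.mp h3)

end Arithmetic

end HKG

namespace HKG

/-! ### The differential of a separating element. -/

section Derivation

open Polynomial TensorProduct

variable {𝕜 F : Type*} [Field 𝕜] [Field F] [Algebra 𝕜 F]

/-- If `x` is a separating transcendental element, then `dx` is a basis of the differentials. -/
lemma exists_coordinate_of_transcendental {x : F} (hx : Transcendental 𝕜 x)
    [Algebra.IsSeparable 𝕜⟮x⟯ F] :
    ∃ δ : Ω[F⁄𝕜] →ₗ[F] F, δ (KaehlerDifferential.D 𝕜 F x) = 1 ∧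
      ∀ ω, ω = δ ω • KaehlerDifferential.D 𝕜 F x := by
  let y : 𝕜⟮x⟯ := IntermediateField.AdjoinSimple.gen 𝕜 x
  let : Algebra 𝕜[X] 𝕜⟮x⟯ := (aeval y).toAlgebra
  let : Algebra 𝕜[X] F := (aeval x).toAlgebra
  have hF : ∀ q : 𝕜[X], algebraMap 𝕜[X] F q = aeval x q := fun q => rfl
  have hK : ∀ q : 𝕜[X], ((algebraMap 𝕜[X] 𝕜⟮x⟯ q : 𝕜⟮x⟯) : F) = aeval x q := fun q => by
    change ((aeval y q : 𝕜⟮x⟯) : F) = _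
    exact (aeval_algebraMap_apply F y q).symm
  have : IsScalarTower 𝕜[X] 𝕜⟮x⟯ F := IsScalarTower.of_algebraMap_eq fun q => (hK q).symm
  have : IsScalarTower 𝕜 𝕜[X] F := IsScalarTower.of_algebraMap_eq fun c => by
    rw [hF, algebraMap_eq, aeval_C]
  have : IsScalarTower 𝕜 𝕜[X] 𝕜⟮x⟯ := IsScalarTower.of_algebraMap_eq fun c => by
    apply Subtype.ext
    rw [hK, algebraMap_eq, aeval_C]
    rfl
  have : FaithfulSMul 𝕜[X] 𝕜⟮x⟯ := by
    rw [faithfulSMul_iff_algebraMap_injective]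
    intro q r h
    exact (transcendental_iff_injective.mp hx) (by rw [← hK, ← hK, h])
  have : IsFractionRing 𝕜[X] 𝕜⟮x⟯ := IsFractionRing.of_field _ _ fun z => by
    obtain ⟨r, s, h⟩ := (IntermediateField.mem_adjoin_simple_iff 𝕜 (z : F)).mp z.2
    exact ⟨r, s, Subtype.ext (by push_cast; rw [h, hK, hK])⟩
  -- `F` is formally étale over `𝕜[X]`, by a localization followed by a separable extension, so its
  -- differentials are the base change of the free module `𝕜[X] dX`.
  have : Algebra.FormallyEtale 𝕜[X] 𝕜⟮x⟯ :=
    Algebra.FormallyEtale.of_isLocalization (nonZeroDivisors 𝕜[X])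
  have : Algebra.FormallyEtale 𝕜⟮x⟯ F := Algebra.FormallyEtale.of_isSeparable _ _
  have : Algebra.FormallyEtale 𝕜[X] F := Algebra.FormallyEtale.comp 𝕜[X] 𝕜⟮x⟯ F
  let e : Ω[F⁄𝕜] ≃ₗ[F] F :=
    (KaehlerDifferential.tensorKaehlerEquivOfFormallyEtale 𝕜 𝕜[X] F).symm ≪≫ₗ
      TensorProduct.AlgebraTensorModule.congr (LinearEquiv.refl F F)
        (KaehlerDifferential.polynomialEquiv 𝕜) ≪≫ₗ
      TensorProduct.AlgebraTensorModule.rid 𝕜[X] F F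
  have he : e (KaehlerDifferential.D 𝕜 F x) = 1 := by
    have hX : x = algebraMap 𝕜[X] F X := by rw [hF, aeval_X]
    simp only [e, LinearEquiv.trans_apply]
    conv_lhs => rw [hX]
    rw [KaehlerDifferential.tensorKaehlerEquivOfFormallyEtale_symm_D_algebraMap]
    simp
  refine ⟨e.toLinearMap, he, fun ω => e.injective ?_⟩
  simp [he]

end Derivation

end HKG

namespace HKG

/-! ### Orders at `P`, reduced monomials and the residue field. -/

section Places

variable {𝕜 F : Type*} [Field 𝕜] [Field F] [Algebra 𝕜 F]

lemma IsPlace.valuation_algebraMap {O : ValuationSubring F} (hO : IsPlace 𝕜 O) {c : 𝕜}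
    (hc : c ≠ 0) : O.valuation (algebraMap 𝕜 F c) = 1 := by
  refine le_antisymm ((O.valuation_le_one_iff _).mpr (hO.contains_constants c)) ?_
  have h := (O.valuation_le_one_iff _).mpr (hO.contains_constants c⁻¹)
  rw [map_inv₀, map_inv₀] at h
  have h0 : O.valuation (algebraMap 𝕜 F c) ≠ 0 := by simpa using hc
  exact (inv_le_one₀ (zero_lt_iff.mpr h0)).mp h

lemma IsPlace.valuation_algebraMap_le {O : ValuationSubring F} (hO : IsPlace 𝕜 O) (c : 𝕜) :
    O.valuation (algebraMap 𝕜 F c) ≤ 1 :=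
  (O.valuation_le_one_iff _).mpr (hO.contains_constants c)

lemma IsUniformizer.valuation_le {O : ValuationSubring F} {t : O} (ht : IsUniformizer O t) {x : F}
    (hx : O.valuation x < 1) : O.valuation x ≤ O.valuation (t : F) := by
  have hxO : x ∈ O := (O.valuation_le_one_iff x).mp hx.le
  have hm : (⟨x, hxO⟩ : O) ∈ IsLocalRing.maximalIdeal O :=
    (O.valuation_lt_one_iff _).mpr hx
  rw [ht, Ideal.mem_span_singleton'] at hm
  obtain ⟨a, ha⟩ := hm
  have hx' : x = (a : F) * (t : F) := by
    rw [← show ((a * t : O) : F) = x by rw [ha]]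
    rfl
  rw [hx', map_mul]
  exact mul_le_of_le_one_left' (O.valuation_le_one a)

lemma IsUniformizer.valuation_lt_one {O : ValuationSubring F} {t : O} (ht : IsUniformizer O t) :
    O.valuation (t : F) < 1 := by
  rw [← O.valuation_lt_one_iff, ht]
  exact Ideal.mem_span_singleton_self t

lemma HasPoleOrder.valuation_mul_pow {O : ValuationSubring F} {t : O} (ht : IsUniformizer O t)
    {x : F} {m : ℕ} (hx : HasPoleOrder O x m) : O.valuation x * O.valuation (t : F) ^ m = 1 := by
  obtain ⟨t', ht', w, hw⟩ := hx
  rw [le_antisymm (ht'.valuation_le ht.valuation_lt_one) (ht.valuation_le ht'.valuation_lt_one),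
    ← map_pow, ← map_mul, hw, O.valuation_unit]

end Places

namespace Tower

variable {p k : ℕ} {𝕜 F : Type*} [Field 𝕜] [Field F] [Algebra 𝕜 F] (T : Tower p k 𝕜 F)

/-- The valuation at `P` has a generator `γ > 1`, with which the orders of the `fⱼ` are known. -/
lemma exists_valuation_eq [Fact p.Prime] :
    ∃ γ : T.P.ValueGroup, 1 < γ ∧
      (∀ j, T.P.valuation (T.f j) = γ ^ weight p T.n T.b j) ∧
      ∀ x, T.P.valuation x < 1 → T.P.valuation x ≤ γ⁻¹ := by
  obtain ⟨t, ht, -⟩ := T.pole 0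
  have h0 : T.P.valuation (t : F) ≠ 0 := by
    intro h
    have h1 := (T.pole 0).valuation_mul_pow ht
    rw [h, zero_pow (weight_pos Fact.out T.b_coprime 0).ne', mul_zero] at h1
    exact zero_ne_one h1
  refine ⟨(T.P.valuation (t : F))⁻¹, (one_lt_inv₀ (zero_lt_iff.mpr h0)).mpr ht.valuation_lt_one,
    fun j => ?_, fun x hx => by simpa using ht.valuation_le hx⟩
  rw [inv_pow]
  exact eq_inv_of_mul_eq_one_left ((T.pole j).valuation_mul_pow ht)

/-- The `𝕜`-span of the reduced monomials. -/
def reducedSpan : Submodule 𝕜 F :=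
  Submodule.span 𝕜 (monom T.f '' {L | Reduced p T.n L})

lemma equation_eq (i : Fin k) :
    T.f i.succ ^ p ^ T.n i + ∑ j ∈ Finset.range (T.n i), T.a i j • T.f i.succ ^ p ^ j =
      Finsupp.linearCombination 𝕜 (monom T.f) (T.d i) := by
  have h := congrArg (Polynomial.eval (T.f i.succ)) (T.equation i)
  rw [Polynomial.eval_map_algebraMap, minpoly.aeval] at h
  simp only [stepPolynomial, Polynomial.eval_sub, Polynomial.eval_add, Polynomial.eval_pow,
    Polynomial.eval_X, Polynomial.eval_C, Polynomial.eval_finsetSum, Polynomial.eval_mul] at h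
  rw [Finsupp.linearCombination_apply, Finsupp.sum]
  simp only [Algebra.smul_def]
  exact (sub_eq_zero.mp h.symm)

lemma monom_add {f : Fin (k + 1) → F} (u v : Fin (k + 1) → ℕ) :
    monom f (u + v) = monom f u * monom f v := by
  simp [monom, pow_add, Finset.prod_mul_distrib]

lemma monom_single {f : Fin (k + 1) → F} (j : Fin (k + 1)) (e : ℕ) :
    monom f (Pi.single j e) = f j ^ e := by
  rw [monom, Finset.prod_eq_single j]
  · simp
  · intro l _ hl
    simp [hl]
  · simp

lemma monom_mem_reducedSpan {L : Fin (k + 1) → ℕ} (hL : Reduced p T.n L) :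
    monom T.f L ∈ T.reducedSpan :=
  Submodule.subset_span ⟨L, hL, rfl⟩

lemma monom_mul_mem {S : Submodule 𝕜 F} {L : Fin (k + 1) → ℕ}
    (h : ∀ j, L j ≠ 0 → ∀ x ∈ S, T.f j * x ∈ S) {x : F} (hx : x ∈ S) : monom T.f L * x ∈ S := by
  have hpow : ∀ j, ∀ x ∈ S, T.f j ^ L j * x ∈ S := by
    intro j
    by_cases h0 : L j = 0
    · simp [h0]
    · intro x hx
      have : ∀ e : ℕ, T.f j ^ e * x ∈ S := by
        intro e
        induction e with
        | zero => simpa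
        | succ e ih => rw [pow_succ', mul_assoc]; exact h j h0 _ ih
      exact this _
  exact Finset.prod_induction (fun j => T.f j ^ L j) (fun y => ∀ x ∈ S, y * x ∈ S)
    (fun a b ha hb x hx => by rw [mul_assoc]; exact ha _ (hb _ hx)) (by simp)
    (fun j _ => hpow j) x hx

/-- Multiplication can only overflow the exponent of `fⱼ` to exactly `p ^ n`; the equation then
replaces this power by smaller powers of `fⱼ` and by monomials of `D` in the earlier generators. The
latter are handled by induction on `j`. -/
lemma f_mul_mem_reducedSpan [Fact p.Prime] (j : Fin (k + 1)) :
    ∀ x ∈ T.reducedSpan, T.f j * x ∈ T.reducedSpan := by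
  have hp : p.Prime := Fact.out
  induction j using WellFoundedLT.induction with
  | ind j ih =>
  intro x hx
  induction hx using Submodule.span_induction with
  | zero => simp
  | add x y _ _ hx hy => rw [mul_add]; exact add_mem hx hy
  | smul c x _ hx => rw [mul_smul_comm]; exact Submodule.smul_mem _ _ hx
  | mem x hx =>
    obtain ⟨L, hL, rfl⟩ := hx
    have hmul : T.f j * monom T.f L = monom T.f (L + Pi.single j 1) := by
      rw [monom_add, monom_single, pow_one, mul_comm]
    by_cases hred : Reduced p T.n (L + Pi.single j 1)
    · rw [hmul]
      exact T.monom_mem_reducedSpan hred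
    · obtain ⟨i, hi⟩ := not_forall.mp hred
      have hij : i.succ = j := by
        by_contra hne
        refine hi ?_
        rw [Pi.add_apply, Pi.single_eq_of_ne hne, add_zero]
        exact hL i
      subst hij
      have hLi : L i.succ + 1 = p ^ T.n i := by
        have := hL i
        simp only [Pi.add_apply, Pi.single_eq_same] at hi
        omega
      set K := Function.update L i.succ 0 with hK
      have hKred : ∀ e < p ^ T.n i, Reduced p T.n (K + Pi.single i.succ e) := by
        intro e he m
        by_cases hm : m = i
        · subst hm
          simpa [hK] using he
        · have hm' : m.succ ≠ i.succ := fun h => hm (Fin.succ_injective _ h)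
          simpa [hK, hm, hm'] using hL m
      have hLK : L + Pi.single i.succ 1 = K + Pi.single i.succ (p ^ T.n i) := by
        funext m
        by_cases hm : m = i.succ
        · subst hm
          simpa [hK] using hLi
        · simp [hK, hm]
      rw [hmul, hLK, monom_add, monom_single, eq_sub_of_add_eq (T.equation_eq i), mul_sub]
      refine sub_mem ?_ ?_
      · rw [mul_comm, Finsupp.linearCombination_apply, Finsupp.sum, Finset.sum_mul]
        refine sum_mem fun l hl => ?_
        rw [smul_mul_assoc]
        refine Submodule.smul_mem _ _ (T.monom_mul_mem (fun m hm => ih m ?_) ?_)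
        · by_contra hlt
          exact hm ((T.d_reduced i l hl).1 m (not_lt.mp hlt))
        · have := hKred 0 (pow_pos hp.pos _)
          rw [Pi.single_zero, add_zero] at this
          exact T.monom_mem_reducedSpan this
      · rw [Finset.mul_sum]
        refine sum_mem fun e he => ?_
        rw [mul_smul_comm, ← monom_single (f := T.f), ← monom_add]
        exact Submodule.smul_mem _ _ (T.monom_mem_reducedSpan
          (hKred _ (Nat.pow_lt_pow_right hp.one_lt (Finset.mem_range.mp he))))

lemma f_mem_adjoin (j : Fin (k + 1)) : T.f j ∈ Algebra.adjoin 𝕜 (Set.range T.f) :=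
  Algebra.subset_adjoin ⟨j, rfl⟩

lemma monom_mem {S : Type*} [SetLike S F] [SubmonoidClass S F] (s : S) {L : Fin (k + 1) → ℕ}
    (h : ∀ j, T.f j ∈ s) : monom T.f L ∈ s :=
  prod_mem fun j _ => pow_mem (h j) _

/-- The reduced monomials span `𝕜[f₀, …, f_k]`. -/
lemma adjoin_le_reducedSpan [Fact p.Prime] {x : F} (hx : x ∈ Algebra.adjoin 𝕜 (Set.range T.f)) :
    x ∈ T.reducedSpan := by
  have hp : p.Prime := Fact.out
  have h1 : (1 : F) ∈ T.reducedSpan := by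
    have := T.monom_mem_reducedSpan (L := 0) fun i => pow_pos hp.pos _
    simpa [monom] using this
  have key : ∀ y ∈ T.reducedSpan, x * y ∈ T.reducedSpan := by
    induction hx using Algebra.adjoin_induction with
    | mem x hx => obtain ⟨j, rfl⟩ := hx; exact T.f_mul_mem_reducedSpan j
    | algebraMap c =>
      intro y hy
      rw [← Algebra.smul_def]
      exact Submodule.smul_mem _ _ hy
    | add x y _ _ hx hy => intro z hz; rw [add_mul]; exact add_mem (hx z hz) (hy z hz)
    | mul x y _ _ hx hy => intro z hz; rw [mul_assoc]; exact hx _ (hy z hz)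
  simpa using key 1 h1

lemma exists_linearCombination [Fact p.Prime] {x : F}
    (hx : x ∈ Algebra.adjoin 𝕜 (Set.range T.f)) :
    ∃ d : (Fin (k + 1) → ℕ) →₀ 𝕜, (∀ l ∈ d.support, Reduced p T.n l) ∧
      Finsupp.linearCombination 𝕜 (monom T.f) d = x := by
  obtain ⟨d, hd, h⟩ :=
    (Finsupp.mem_span_image_iff_linearCombination 𝕜).mp (T.adjoin_le_reducedSpan hx)
  exact ⟨d, fun l hl => (Finsupp.mem_supported 𝕜 d).mp hd hl, h⟩

lemma exists_eq_div (x : F) : ∃ y ∈ Algebra.adjoin 𝕜 (Set.range T.f),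
    ∃ s ∈ Algebra.adjoin 𝕜 (Set.range T.f), x = y / s := by
  have hx : x ∈ IntermediateField.adjoin 𝕜 (Set.range T.f) := by
    rw [T.generate]
    exact IntermediateField.mem_top
  obtain ⟨y, hy, s, hs, h⟩ := IntermediateField.mem_adjoin_iff_div.mp hx
  exact ⟨y, hy, s, hs, h⟩

section Valuation

variable {T} {γ : T.P.ValueGroup}

lemma valuation_monom (hf : ∀ j, T.P.valuation (T.f j) = γ ^ weight p T.n T.b j)
    (L : Fin (k + 1) → ℕ) : T.P.valuation (monom T.f L) = γ ^ wnorm p T.n T.b L := by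
  simp only [monom, map_prod, map_pow, hf, wnorm, ← Finset.prod_pow_eq_pow_sum, ← pow_mul]
  exact Finset.prod_congr rfl fun j _ => by rw [mul_comm]

/-- A combination of reduced monomials has a leading term, which determines its order at `P`. -/
lemma exists_leading [Fact p.Prime] (hγ : 1 < γ)
    (hf : ∀ j, T.P.valuation (T.f j) = γ ^ weight p T.n T.b j)
    {d : (Fin (k + 1) → ℕ) →₀ 𝕜} (hd : ∀ l ∈ d.support, Reduced p T.n l) (h0 : d ≠ 0) :
    ∃ l ∈ d.support, (∀ m ∈ d.support, m ≠ l → wnorm p T.n T.b m < wnorm p T.n T.b l) ∧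
      T.P.valuation (Finsupp.linearCombination 𝕜 (monom T.f) d) = γ ^ wnorm p T.n T.b l ∧
      T.P.valuation (Finsupp.linearCombination 𝕜 (monom T.f) d - d l • monom T.f l) <
        γ ^ wnorm p T.n T.b l := by
  have hp : p.Prime := Fact.out
  obtain ⟨l, hl, hmax⟩ := d.support.exists_max_image (wnorm p T.n T.b)
    (Finsupp.support_nonempty_iff.mpr h0)
  -- Reduced exponents are determined by their norms, so the maximum is attained once and no
  -- cancellation of leading terms can occur.
  have hlt : ∀ m ∈ d.support, m ≠ l → wnorm p T.n T.b m < wnorm p T.n T.b l := fun m hm hne =>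
    lt_of_le_of_ne (hmax m hm) fun h => hne (wnorm_injOn hp T.b_coprime (hd m hm) (hd l hl) h)
  have hterm : ∀ m ∈ d.support,
      T.P.valuation (d m • monom T.f m) = γ ^ wnorm p T.n T.b m := fun m hm => by
    rw [Algebra.smul_def, map_mul, T.cover.place.valuation_algebraMap (Finsupp.mem_support_iff.mp hm),
      one_mul, valuation_monom hf]
  have hγ0 : γ ≠ 0 := (zero_lt_one.trans hγ).ne'
  have hsub : Finsupp.linearCombination 𝕜 (monom T.f) d - d l • monom T.f l =
      ∑ m ∈ d.support.erase l, d m • monom T.f m := by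
    rw [Finsupp.linearCombination_apply, Finsupp.sum, ← Finset.add_sum_erase _ _ hl]
    exact add_sub_cancel_left _ _
  have hrest : T.P.valuation (Finsupp.linearCombination 𝕜 (monom T.f) d - d l • monom T.f l) <
      γ ^ wnorm p T.n T.b l := by
    rw [hsub]
    refine Valuation.map_sum_lt _ (pow_ne_zero _ hγ0) fun m hm => ?_
    rw [hterm m (Finset.mem_of_mem_erase hm)]
    exact pow_lt_pow_right₀ hγ (hlt m (Finset.mem_of_mem_erase hm) (Finset.ne_of_mem_erase hm))
  refine ⟨l, hl, hlt, ?_, hrest⟩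
  rw [← hterm l hl]
  rw [← hterm l hl] at hrest
  have := Valuation.map_add_eq_of_lt_left _ hrest
  rwa [add_sub_cancel] at this

lemma pow_wnorm_le_valuation [Fact p.Prime] (hγ : 1 < γ)
    (hf : ∀ j, T.P.valuation (T.f j) = γ ^ weight p T.n T.b j)
    {d : (Fin (k + 1) → ℕ) →₀ 𝕜} (hd : ∀ l ∈ d.support, Reduced p T.n l)
    {l : Fin (k + 1) → ℕ} (hl : l ∈ d.support) :
    γ ^ wnorm p T.n T.b l ≤
      T.P.valuation (Finsupp.linearCombination 𝕜 (monom T.f) d) := by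
  have h0 : d ≠ 0 := by
    rintro rfl
    simp at hl
  obtain ⟨m, -, hlt, h, -⟩ := exists_leading hγ hf hd h0
  rw [h]
  refine pow_le_pow_right₀ hγ.le ?_
  by_cases hlm : l = m
  · rw [hlm]
  · exact (hlt l hl hlm).le

/-- The residue field of `P` is `𝕜`. -/
lemma exists_valuation_sub_lt_one [Fact p.Prime] (hγ : 1 < γ)
    (hf : ∀ j, T.P.valuation (T.f j) = γ ^ weight p T.n T.b j) {x : F}
    (hx : x ∈ T.P) : ∃ c : 𝕜, T.P.valuation (x - algebraMap 𝕜 F c) < 1 := by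
  have hp : p.Prime := Fact.out
  have hγ0 : γ ≠ 0 := (zero_lt_one.trans hγ).ne'
  rcases lt_or_eq_of_le ((T.P.valuation_le_one_iff x).mpr hx) with h1 | h1
  · exact ⟨0, by simpa using h1⟩
  obtain ⟨y, hy, s, hs, rfl⟩ := T.exists_eq_div x
  obtain ⟨d, hd, rfl⟩ := T.exists_linearCombination hy
  obtain ⟨e, he, rfl⟩ := T.exists_linearCombination hs
  have hd0 : d ≠ 0 := by rintro rfl; simp at h1
  have he0 : e ≠ 0 := by rintro rfl; simp at h1
  obtain ⟨l, hl, -, hdv, hdr⟩ := exists_leading hγ hf hd hd0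
  obtain ⟨m, hm, -, hev, her⟩ := exists_leading hγ hf he he0
  set y := Finsupp.linearCombination 𝕜 (monom T.f) d
  set s := Finsupp.linearCombination 𝕜 (monom T.f) e
  have hsv : T.P.valuation s ≠ 0 := by rw [hev]; exact pow_ne_zero _ hγ0
  have hs0 : s ≠ 0 := fun h => hsv (by rw [h, map_zero])
  rw [map_div₀, div_eq_one_iff_eq hsv, hdv, hev] at h1
  -- Numerator and denominator have the same pole order, hence the same leading exponent; the
  -- residue of the quotient is the ratio of their leading coefficients.
  obtain rfl : l = m :=
    wnorm_injOn hp T.b_coprime (hd l hl) (he m hm) (pow_right_injective₀ (zero_lt_one.trans hγ) hγ.ne' h1)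
  have hel : e l ≠ 0 := Finsupp.mem_support_iff.mp hm
  refine ⟨d l / e l, ?_⟩
  have hnum : y / s - algebraMap 𝕜 F (d l / e l) =
      ((y - d l • monom T.f l) - algebraMap 𝕜 F (d l / e l) * (s - e l • monom T.f l)) / s := by
    have : algebraMap 𝕜 F (e l) ≠ 0 := by simpa using hel
    rw [Algebra.smul_def, Algebra.smul_def, map_div₀]
    field_simp
    ring
  rw [hnum, map_div₀, div_lt_one₀ (zero_lt_iff.mpr hsv), hev]
  refine Valuation.map_sub_lt _ hdr ?_
  rw [map_mul]
  exact lt_of_le_of_lt (mul_le_of_le_one_left' (T.cover.place.valuation_algebraMap_le _)) her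

end Valuation

end Tower

end HKG

namespace HKG

/-! ### Logarithmic derivatives and the order of `df₀` at `P`. -/

section LogOrder

variable {p k : ℕ} {n b : Fin k → ℕ}

/-- The order of the pole at `P` of the logarithmic derivative of `fₘ` with respect to `f₀`. -/
def logOrder (p : ℕ) {k : ℕ} (n b : Fin k → ℕ) (m : Fin (k + 1)) : ℤ :=
  ∑ i : Fin k with i.succ ≤ m, ((p : ℤ) ^ n i - 1) * weight p n b i.succ - weight p n b 0

lemma logOrder_zero : logOrder p n b 0 = - (weight p n b 0 : ℤ) := by
  have : Finset.univ.filter (fun i : Fin k => i.succ ≤ 0) = ∅ :=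
    Finset.filter_eq_empty_iff.mpr fun i _ => not_le.mpr (Fin.succ_pos i)
  rw [logOrder, this, Finset.sum_empty, zero_sub]

/-- This is the recursion imposed by `aᵢ₀ dfᵢ = dDᵢ`: `Dᵢ` has pole order `p ^ nᵢ m̄ᵢ`, its
logarithmic derivative has the order belonging to the preceding generator, and passing to the
logarithmic derivative of `fᵢ` subtracts `m̄ᵢ`. -/
lemma logOrder_succ (i : Fin k) : logOrder p n b i.succ =
    logOrder p n b i.castSucc + ((p : ℤ) ^ n i - 1) * weight p n b i.succ := by
  have : Finset.univ.filter (fun j : Fin k => j.succ ≤ i.succ) =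
      insert i (Finset.univ.filter fun j : Fin k => j.succ ≤ i.castSucc) := by
    ext j
    simp only [Finset.mem_filter, Finset.mem_univ, true_and, Finset.mem_insert,
      Fin.le_def, Fin.val_succ, Fin.val_castSucc, Fin.ext_iff]
    omega
  have hnot : i ∉ Finset.univ.filter (fun j : Fin k => j.succ ≤ i.castSucc) := by
    simp [Fin.le_def]
  rw [logOrder, logOrder, this, Finset.sum_insert hnot]
  ring

lemma logOrder_last : logOrder p n b (Fin.last k) = frobeniusNumber p n b := by
  simp [logOrder, frobeniusNumber, Fin.le_last]

lemma logOrder_strictMono (hp : p.Prime) (hn : ∀ i, 0 < n i) (hb : ∀ i, (b i).Coprime p) :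
    StrictMono (logOrder p n b) := by
  rw [Fin.strictMono_iff_lt_succ]
  intro i
  rw [logOrder_succ, lt_add_iff_pos_right]
  refine mul_pos (sub_pos.mpr ?_) (by exact_mod_cast weight_pos hp hb _)
  exact_mod_cast Nat.one_lt_pow (hn i).ne' hp.one_lt

end LogOrder

section LogBound

variable {𝕜 F Γ₀ : Type*} [Field 𝕜] [Field F] [Algebra 𝕜 F] [LinearOrderedCommGroupWithZero Γ₀]
  {v : Valuation F Γ₀} {D : Derivation 𝕜 F F} {κ : Γ₀}

/-- The logarithmic derivative turns products into sums, so a common bound `κ` on logarithmic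
derivatives is inherited by products, powers and quotients. -/
lemma valuation_derivation_mul_le {x y : F} (hx : v (D x) ≤ v x * κ) (hy : v (D y) ≤ v y * κ) :
    v (D (x * y)) ≤ v (x * y) * κ := by
  rw [Derivation.leibniz, smul_eq_mul, smul_eq_mul]
  refine Valuation.map_add_le _ ?_ ?_
  · rw [map_mul, map_mul, mul_assoc]
    exact mul_le_mul_right hy _
  · rw [map_mul, map_mul, mul_comm (v x), mul_assoc]
    exact mul_le_mul_right hx _

lemma valuation_derivation_pow_le {x : F} (hx : v (D x) ≤ v x * κ) (e : ℕ) :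
    v (D (x ^ e)) ≤ v (x ^ e) * κ := by
  induction e with
  | zero => simp
  | succ e ih => rw [pow_succ]; exact valuation_derivation_mul_le ih hx

lemma valuation_derivation_div_le {x y : F} (hx : v (D x) ≤ v x * κ) (hy : v (D y) ≤ v y * κ) :
    v (D (x / y)) ≤ v (x / y) * κ := by
  by_cases hy0 : y = 0
  · simp [hy0]
  have hinv : v (D y⁻¹) ≤ v y⁻¹ * κ := by
    have h0 : v y ≠ 0 := by simpa using hy0
    rw [Derivation.leibniz_inv, smul_eq_mul, map_mul, Valuation.map_neg, map_pow, map_inv₀, sq,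
      mul_assoc]
    refine mul_le_mul_right ?_ _
    rwa [inv_mul_le_iff₀ (zero_lt_iff.mpr h0)]
  rw [div_eq_mul_inv]
  exact valuation_derivation_mul_le hx hinv

lemma valuation_derivation_monom_le {k : ℕ} {f : Fin (k + 1) → F} {L : Fin (k + 1) → ℕ}
    (h : ∀ j, L j ≠ 0 → v (D (f j)) ≤ v (f j) * κ) :
    v (D (monom f L)) ≤ v (monom f L) * κ := by
  refine Finset.prod_induction (fun j => f j ^ L j) (fun y => v (D y) ≤ v y * κ)
    (fun a b ha hb => valuation_derivation_mul_le ha hb) (by simp) fun j _ => ?_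
  by_cases h0 : L j = 0
  · simp [h0]
  · exact valuation_derivation_pow_le (h j h0) _

end LogBound

namespace Tower

variable {p k : ℕ} {𝕜 F : Type*} [Field 𝕜] [Field F] [Algebra 𝕜 F] {T : Tower p k 𝕜 F}
  {γ : T.P.ValueGroup} {D : Derivation 𝕜 F F}

lemma derivation_pow_prime_pow [CharP 𝕜 p] (x : F) {j : ℕ} (hj : j ≠ 0) : D (x ^ p ^ j) = 0 := by
  have := charP_of_injective_algebraMap (algebraMap 𝕜 F).injective p
  rw [Derivation.leibniz_pow, ← Nat.cast_smul_eq_nsmul F]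
  simp [hj]

-- A derivation kills `p`-th powers, so only the linear term of the additive polynomial survives.
variable (T) in
lemma smul_derivation_eq [CharP 𝕜 p] (D : Derivation 𝕜 F F) (i : Fin k) :
    T.a i 0 • D (T.f i.succ) = D (Finsupp.linearCombination 𝕜 (monom T.f) (T.d i)) := by
  rw [← T.equation_eq i, map_add, map_sum, derivation_pow_prime_pow _ (T.n_pos i).ne', zero_add,
    Finset.sum_eq_single_of_mem 0 (Finset.mem_range.mpr (T.n_pos i))]
  · simp
  · intro j _ hj
    rw [Derivation.map_smul, derivation_pow_prime_pow _ hj, smul_zero]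

lemma reduced_of_mem_support [Fact p.Prime] {i : Fin k} {l : Fin (k + 1) → ℕ}
    (hl : l ∈ (T.d i).support) : Reduced p T.n l :=
  reduced_of_mem_reducedExponents (Fact.out : p.Prime).pos (T.d_reduced i l hl)

lemma valuation_linearCombination_d [Fact p.Prime] (hγ : 1 < γ)
    (hf : ∀ j, T.P.valuation (T.f j) = γ ^ weight p T.n T.b j) (i : Fin k) :
    T.P.valuation (Finsupp.linearCombination 𝕜 (monom T.f) (T.d i)) =
      γ ^ (p ^ T.n i * weight p T.n T.b i.succ) := by
  have hp : p.Prime := Fact.out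
  have hw := weight_pos (n := T.n) hp T.b_coprime i.succ
  have htop : T.P.valuation (T.f i.succ ^ p ^ T.n i) =
      γ ^ (p ^ T.n i * weight p T.n T.b i.succ) := by
    rw [map_pow, hf, ← pow_mul, mul_comm]
  rw [← T.equation_eq i, ← htop]
  refine Valuation.map_add_eq_of_lt_left _ ?_
  rw [htop]
  refine Valuation.map_sum_lt _ (pow_ne_zero _ (zero_lt_one.trans hγ).ne') fun j hj => ?_
  rw [Algebra.smul_def, map_mul, map_pow, hf, ← pow_mul, mul_comm (weight _ _ _ _)]
  refine lt_of_le_of_lt (mul_le_of_le_one_left' (T.cover.place.valuation_algebraMap_le _)) ?_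
  exact pow_lt_pow_right₀ hγ ((Nat.mul_lt_mul_right hw).mpr
    (Nat.pow_lt_pow_right hp.one_lt (Finset.mem_range.mp hj)))

lemma d_ne_zero [Fact p.Prime] (hγ : 1 < γ)
    (hf : ∀ j, T.P.valuation (T.f j) = γ ^ weight p T.n T.b j) (i : Fin k) : T.d i ≠ 0 := by
  intro h
  have := valuation_linearCombination_d hγ hf i
  rw [h, map_zero, map_zero] at this
  exact pow_ne_zero _ (zero_lt_one.trans hγ).ne' this.symm

/-- The order at `P` of the derivatives of the monomials of leading exponent in `Dᵢ`. -/
lemma valuation_derivation_monom_leading [Fact p.Prime] [CharP 𝕜 p] (hγ : 1 < γ)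
    (hf : ∀ j, T.P.valuation (T.f j) = γ ^ weight p T.n T.b j) {i : Fin k}
    (hD : ∀ j, j < i.succ → T.P.valuation (D (T.f j)) =
      T.P.valuation (T.f j) * γ ^ logOrder p T.n T.b j)
    {l : Fin (k + 1) → ℕ} (hl : l ∈ reducedExponents p T.n i) (hdvd : ¬ p ∣ l i.castSucc) :
    T.P.valuation (D (monom T.f l)) =
      T.P.valuation (monom T.f l) * γ ^ logOrder p T.n T.b i.castSucc := by
  have hp : p.Prime := Fact.out
  have hγ0 : γ ≠ 0 := (zero_lt_one.trans hγ).ne'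
  set m := i.castSucc with hm
  have hf0 : ∀ j, T.P.valuation (T.f j) ≠ 0 := fun j => by
    rw [hf]; exact pow_ne_zero _ hγ0
  obtain ⟨e, he⟩ : ∃ e, l m = e + 1 :=
    Nat.exists_eq_succ_of_ne_zero fun h => hdvd (h ▸ dvd_zero p)
  set K := Function.update l m 0 with hK
  have hlK : l = K + Pi.single m (l m) := by
    funext j
    by_cases hj : j = m
    · subst hj; simp [hK]
    · simp [hK, hj]
  have hmon : monom T.f l = monom T.f K * T.f m ^ l m := by
    conv_lhs => rw [hlK]
    rw [monom_add, monom_single]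
  have hcast : T.P.valuation ((l m : ℕ) : F) = 1 := by
    rw [← map_natCast (algebraMap 𝕜 F)]
    exact T.cover.place.valuation_algebraMap (by rwa [Ne, CharP.cast_eq_zero_iff 𝕜 p])
  have hpow : T.P.valuation (D (T.f m ^ l m)) =
      T.P.valuation (T.f m ^ l m) * γ ^ logOrder p T.n T.b m := by
    rw [Derivation.leibniz_pow, ← Nat.cast_smul_eq_nsmul F, smul_eq_mul, smul_eq_mul, map_mul,
      hcast, one_mul, map_mul, hD m Fin.castSucc_lt_succ, he, Nat.add_sub_cancel, map_pow, map_pow,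
      pow_succ, mul_assoc]
  -- The remaining factors have index below `m`; since the logarithmic orders are strictly
  -- increasing integers, they are at most the order of `fₘ` minus one. Hence the term that
  -- differentiates `fₘ` dominates the product rule.
  have hrest : T.P.valuation (D (monom T.f K)) ≤
      T.P.valuation (monom T.f K) * γ ^ (logOrder p T.n T.b m - 1) := by
    refine valuation_derivation_monom_le fun j hj => ?_
    have hjm : j < m := by
      by_contra hmj
      rcases (not_lt.mp hmj).eq_or_lt with h | h
      · exact hj (by simp [hK, h])
      · refine hj ?_
        rw [hK, Function.update_of_ne h.ne']
        exact hl.1 j (Fin.castSucc_lt_iff_succ_le.mp h)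
    rw [hD j (hjm.trans Fin.castSucc_lt_succ)]
    refine mul_le_mul_right (zpow_le_zpow_right₀ hγ.le ?_) _
    have := logOrder_strictMono (n := T.n) hp T.n_pos T.b_coprime hjm
    omega
  have hK0 : T.P.valuation (monom T.f K) ≠ 0 := by
    rw [valuation_monom hf]; exact pow_ne_zero _ hγ0
  have hmain : T.P.valuation (monom T.f K * D (T.f m ^ l m)) =
      T.P.valuation (monom T.f l) * γ ^ logOrder p T.n T.b m := by
    rw [map_mul, hpow, hmon, map_mul, mul_assoc]
  conv_lhs => rw [hmon]
  rw [Derivation.leibniz, smul_eq_mul, smul_eq_mul, ← hmain]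
  refine Valuation.map_add_eq_of_lt_left _ ?_
  rw [map_mul, map_mul, hpow, mul_left_comm]
  have hm0 : 0 < T.P.valuation (T.f m ^ l m) := by
    rw [map_pow]; exact zero_lt_iff.mpr (pow_ne_zero _ (hf0 m))
  refine mul_lt_mul_of_pos_left (lt_of_le_of_lt hrest ?_) hm0
  exact mul_lt_mul_of_pos_left (zpow_lt_zpow_right₀ hγ (by omega)) (zero_lt_iff.mpr hK0)

/-- The leading monomial stays dominant after differentiation: its entry at `i.castSucc` is prime to
`p`, so it attains the largest logarithmic order available, while every other monomial has a smaller
pole and no larger logarithmic order. -/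
lemma valuation_derivation_linearCombination_d [Fact p.Prime] [CharP 𝕜 p] (hγ : 1 < γ)
    (hf : ∀ j, T.P.valuation (T.f j) = γ ^ weight p T.n T.b j) {i : Fin k}
    (hD : ∀ j, j < i.succ → T.P.valuation (D (T.f j)) =
      T.P.valuation (T.f j) * γ ^ logOrder p T.n T.b j) :
    T.P.valuation (D (Finsupp.linearCombination 𝕜 (monom T.f) (T.d i))) =
      γ ^ (p ^ T.n i * weight p T.n T.b i.succ) * γ ^ logOrder p T.n T.b i.castSucc := by
  have hp : p.Prime := Fact.out
  have hγ0 : γ ≠ 0 := (zero_lt_one.trans hγ).ne'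
  obtain ⟨l, hl, hlt, hv, -⟩ := exists_leading hγ hf
    (fun l hl => reduced_of_mem_support hl) (d_ne_zero hγ hf i)
  rw [valuation_linearCombination_d hγ hf i] at hv
  have hnorm : wnorm p T.n T.b l = p ^ T.n i * weight p T.n T.b i.succ :=
    (pow_right_injective₀ (zero_lt_one.trans hγ) hγ.ne' hv).symm
  have hlead := valuation_derivation_monom_leading hγ hf hD (T.d_reduced i l hl)
    (not_dvd_of_wnorm_eq hp T.n_pos T.b_coprime (T.d_reduced i l hl) hnorm)
  rw [valuation_monom hf, hnorm] at hlead
  have hterm : ∀ m ∈ (T.d i).support, T.P.valuation (D (T.d i m • monom T.f m)) =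
      T.P.valuation (D (monom T.f m)) := fun m hm => by
    rw [Derivation.map_smul, Algebra.smul_def, map_mul,
      T.cover.place.valuation_algebraMap (Finsupp.mem_support_iff.mp hm), one_mul]
  rw [Finsupp.linearCombination_apply, Finsupp.sum, ← Finset.add_sum_erase _ _ hl, map_add, map_sum,
    ← hlead, ← hterm l hl]
  refine Valuation.map_add_eq_of_lt_left _ ?_
  rw [hterm l hl, hlead]
  refine Valuation.map_sum_lt _ (mul_ne_zero (pow_ne_zero _ hγ0) (zpow_ne_zero _ hγ0))
    fun m hm => ?_
  have hms := Finset.mem_of_mem_erase hm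
  rw [hterm m hms]
  refine lt_of_le_of_lt (valuation_derivation_monom_le
    (κ := γ ^ logOrder p T.n T.b i.castSucc) fun j hj => ?_) ?_
  · have hji : j < i.succ := by
      by_contra h
      exact hj ((T.d_reduced i m hms).1 j (not_lt.mp h))
    rw [hD j hji]
    exact mul_le_mul_right (zpow_le_zpow_right₀ hγ.le
      ((logOrder_strictMono hp T.n_pos T.b_coprime).monotone (Fin.le_castSucc_iff.mpr hji))) _
  · rw [valuation_monom hf, ← hnorm]
    exact mul_lt_mul_of_pos_right
      (pow_lt_pow_right₀ hγ (hlt m hms (Finset.ne_of_mem_erase hm)))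
      (zero_lt_iff.mpr (zpow_ne_zero _ hγ0))

/-- The order at `P` of the derivatives of the generators with respect to `f₀`. -/
lemma valuation_derivation_f [Fact p.Prime] [CharP 𝕜 p] (hγ : 1 < γ)
    (hf : ∀ j, T.P.valuation (T.f j) = γ ^ weight p T.n T.b j) (hD : D (T.f 0) = 1)
    (j : Fin (k + 1)) :
    T.P.valuation (D (T.f j)) = T.P.valuation (T.f j) * γ ^ logOrder p T.n T.b j := by
  have hγ0 : γ ≠ 0 := (zero_lt_one.trans hγ).ne'
  induction j using WellFoundedLT.induction with
  | ind j ih =>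
  induction j using Fin.cases with
  | zero =>
    rw [hD, map_one, hf, logOrder_zero, zpow_neg, zpow_natCast,
      mul_inv_cancel₀ (pow_ne_zero _ hγ0)]
  | succ i =>
    have h := valuation_derivation_linearCombination_d hγ hf ih
    rw [← T.smul_derivation_eq D i, Algebra.smul_def, map_mul] at h
    have ha : T.a i 0 ≠ 0 := by
      intro ha
      rw [ha, map_zero, map_zero, zero_mul] at h
      exact mul_ne_zero (pow_ne_zero _ hγ0) (zpow_ne_zero _ hγ0) h.symm
    rw [T.cover.place.valuation_algebraMap ha, one_mul] at h
    rw [h, hf, ← zpow_natCast, ← zpow_natCast, ← zpow_add₀ hγ0, ← zpow_add₀ hγ0, logOrder_succ]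
    congr 1
    push_cast
    ring

/-- Otherwise the derivative of `Dᵢ` would vanish, although its order at `P` is finite. This is what
makes the steps of the tower étale over the affine part. -/
lemma a_zero_ne_zero [Fact p.Prime] [CharP 𝕜 p] (hD : D (T.f 0) = 1) (i : Fin k) :
    T.a i 0 ≠ 0 := by
  obtain ⟨γ, hγ, hf, -⟩ := T.exists_valuation_eq
  have hγ0 : γ ≠ 0 := (zero_lt_one.trans hγ).ne'
  intro ha
  have h := valuation_derivation_linearCombination_d hγ hf (i := i)
    fun j _ => valuation_derivation_f hγ hf hD j
  rw [← T.smul_derivation_eq D i, ha, zero_smul, map_zero] at h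
  exact mul_ne_zero (pow_ne_zero _ hγ0) (zpow_ne_zero _ hγ0) h.symm

lemma valuation_derivation_le [Fact p.Prime] [CharP 𝕜 p] (hγ : 1 < γ)
    (hf : ∀ j, T.P.valuation (T.f j) = γ ^ weight p T.n T.b j) (hD : D (T.f 0) = 1) (x : F) :
    T.P.valuation (D x) ≤ T.P.valuation x * γ ^ frobeniusNumber p T.n T.b := by
  have hp : p.Prime := Fact.out
  have hγ0 : γ ≠ 0 := (zero_lt_one.trans hγ).ne'
  have key : ∀ y ∈ Algebra.adjoin 𝕜 (Set.range T.f),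
      T.P.valuation (D y) ≤ T.P.valuation y * γ ^ frobeniusNumber p T.n T.b := by
    intro y hy
    obtain ⟨d, hd, rfl⟩ := T.exists_linearCombination hy
    conv_lhs => rw [Finsupp.linearCombination_apply, Finsupp.sum, map_sum]
    refine Valuation.map_sum_le _ fun l hl => ?_
    rw [Derivation.map_smul, Algebra.smul_def, map_mul]
    refine (mul_le_of_le_one_left' (T.cover.place.valuation_algebraMap_le _)).trans ?_
    refine (valuation_derivation_monom_le (κ := γ ^ frobeniusNumber p T.n T.b)
      fun j _ => ?_).trans ?_
    · rw [valuation_derivation_f hγ hf hD, ← logOrder_last]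
      exact mul_le_mul_right (zpow_le_zpow_right₀ hγ.le
        ((logOrder_strictMono hp T.n_pos T.b_coprime).monotone (Fin.le_last j))) _
    · rw [valuation_monom hf]
      exact mul_le_mul_left (pow_wnorm_le_valuation hγ hf hd hl) _
  obtain ⟨y, hy, s, hs, rfl⟩ := T.exists_eq_div x
  exact valuation_derivation_div_le (key y hy) (key s hs)

/-- The order at `P` of the differential of a function that is regular at `P`. -/
lemma valuation_derivation_le_of_mem [Fact p.Prime] [CharP 𝕜 p] (hγ : 1 < γ)
    (hf : ∀ j, T.P.valuation (T.f j) = γ ^ weight p T.n T.b j)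
    (hγt : ∀ x, T.P.valuation x < 1 → T.P.valuation x ≤ γ⁻¹) (hD : D (T.f 0) = 1)
    {x : F} (hx : x ∈ T.P) :
    T.P.valuation (D x) ≤ γ ^ (frobeniusNumber p T.n T.b - 1) := by
  have hγ0 : γ ≠ 0 := (zero_lt_one.trans hγ).ne'
  -- Removing the residue, a constant, leaves the derivative unchanged and gains the factor `γ⁻¹`,
  -- hence the exponent `N - 1`.
  obtain ⟨c, hc⟩ := exists_valuation_sub_lt_one hγ hf hx
  have h := valuation_derivation_le hγ hf hD (x - algebraMap 𝕜 F c)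
  rw [map_sub, Derivation.map_algebraMap, sub_zero] at h
  refine h.trans ((mul_le_mul_left (hγt _ hc) _).trans_eq ?_)
  rw [zpow_sub_one₀ hγ0, mul_comm]

/-- There is a function that is regular at `P` and whose differential generates the differentials
at `P`. -/
lemma exists_valuation_derivation_eq [Fact p.Prime] [CharP 𝕜 p] (hγ : 1 < γ)
    (hf : ∀ j, T.P.valuation (T.f j) = γ ^ weight p T.n T.b j) (hD : D (T.f 0) = 1) :
    ∃ t ∈ T.P, T.P.valuation (D t) = γ ^ (frobeniusNumber p T.n T.b - 1) := by
  have hp : p.Prime := Fact.out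
  have hγ0 : γ ≠ 0 := (zero_lt_one.trans hγ).ne'
  set w := weight p T.n T.b (Fin.last k) with hw
  have hcop : w.Coprime p := by
    rw [hw]
    rcases Nat.eq_zero_or_pos k with rfl | hk
    · simp [show Fin.last 0 = 0 from rfl]
    · obtain ⟨i, hi⟩ := Fin.exists_succ_eq.mpr
        (show Fin.last k ≠ 0 from fun h => hk.ne' (by simpa using congrArg Fin.val h))
      have hI : Finset.Ioi i = ∅ := by
        refine Finset.Ioi_eq_empty.mpr fun j _ => ?_
        rw [← Fin.succ_le_succ_iff, hi]
        exact Fin.le_last _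
      rw [← hi, weight_succ, hI, Finset.sum_empty, pow_zero, one_mul]
      exact T.b_coprime i
  -- The witness will be the uniformizer `t = f_k ^ y * (f₀ ^ (-x)) ^ p`. The extra factor `p` in
  -- the congruence makes the second factor a `p`-th power, which the derivation ignores, and forces
  -- `p ∤ y`, so that `D t` has exactly the order predicted by `f_k`.
  obtain ⟨y, x, hyx⟩ : ∃ y x : ℕ, y * w + 1 = p * weight p T.n T.b 0 * x := by
    have hc : Nat.Coprime w (p * weight p T.n T.b 0) := by
      rw [weight_zero]
      exact Nat.Coprime.mul_right hcop (hcop.pow_right _)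
    have hq : 1 < p * weight p T.n T.b 0 :=
      lt_of_lt_of_le hp.one_lt (Nat.le_mul_of_pos_right p (weight_pos hp T.b_coprime 0))
    obtain ⟨z, hz⟩ := Nat.exists_mul_mod_eq_one_of_coprime hc hq
    refine ⟨z * (p * weight p T.n T.b 0 - 1), ?_⟩
    set q := p * weight p T.n T.b 0
    refine ⟨z * w - w * z / q, ?_⟩
    have h1 := Nat.div_add_mod (w * z) q
    rw [hz.2] at h1
    have h2 : w * z / q ≤ z * w := (Nat.div_le_self _ _).trans_eq (mul_comm _ _)
    zify [h2, hq.le] at h1 ⊢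
    linear_combination h1
  have hy : ¬ p ∣ y := fun h => hp.one_lt.ne' (Nat.dvd_one.mp
    ((Nat.dvd_add_right (h.mul_right w)).mp (hyx ▸ (dvd_mul_right p _).mul_right x)))
  obtain ⟨e, he⟩ : ∃ e, y = e + 1 :=
    Nat.exists_eq_succ_of_ne_zero fun h => hy (h ▸ dvd_zero p)
  set ℓ := T.f (Fin.last k) with hℓ
  set c : F := (T.f 0 ^ x)⁻¹ with hc
  have hcv : T.P.valuation (c ^ p) = (γ ^ (y * w + 1))⁻¹ := by
    rw [hyx, hc, inv_pow, map_inv₀, map_pow, map_pow, hf, ← pow_mul, ← pow_mul]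
    congr 2
    ring
  have hℓv : T.P.valuation (ℓ ^ y) = γ ^ (y * w) := by
    rw [map_pow, hℓ, hf, ← pow_mul, mul_comm]
  have hprod : γ ^ (y * w) * (γ ^ (y * w + 1))⁻¹ = γ⁻¹ := by
    rw [pow_succ, mul_inv, mul_inv_cancel_left₀ (pow_ne_zero _ hγ0)]
  refine ⟨ℓ ^ y * c ^ p, ?_, ?_⟩
  · rw [← T.P.valuation_le_one_iff, map_mul, hℓv, hcv, hprod]
    exact inv_le_one_of_one_le₀ hγ.le
  · have hDc : D (c ^ p) = 0 := by
      have := derivation_pow_prime_pow (p := p) (D := D) c one_ne_zero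
      rwa [pow_one] at this
    have hcast : T.P.valuation ((y : ℕ) : F) = 1 := by
      rw [← map_natCast (algebraMap 𝕜 F)]
      exact T.cover.place.valuation_algebraMap (by rwa [Ne, CharP.cast_eq_zero_iff 𝕜 p])
    have hpow : T.P.valuation (D (ℓ ^ y)) = γ ^ (y * w) * γ ^ frobeniusNumber p T.n T.b := by
      rw [Derivation.leibniz_pow, ← Nat.cast_smul_eq_nsmul F, smul_eq_mul, smul_eq_mul, map_mul,
        hcast, one_mul, map_mul, hℓ, valuation_derivation_f hγ hf hD, ← mul_assoc, ← map_mul,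
        he, Nat.add_sub_cancel, ← pow_succ, ← he, ← hℓ, hℓv, logOrder_last]
    rw [Derivation.leibniz, hDc, smul_zero, zero_add, smul_eq_mul, map_mul, hpow, hcv,
      zpow_sub_one₀ hγ0, ← hprod]
    ac_rfl

end Tower

end HKG

namespace HKG

/-! ### Normality of `𝕜[f₀, …, f_k]`. -/

section IntegralClosure

open Polynomial

/-- Adjoining a root of a monic polynomial whose derivative takes a unit value at the root
preserves normality. -/
lemma mem_adjoin_of_isIntegral {R K F : Type*} [CommRing R] [IsDomain R] [IsIntegrallyClosed R]
    [Field K] [Field F] [Algebra R K] [IsFractionRing R K] [Algebra K F] [Algebra R F]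
    [IsScalarTower R K F] {z : F} (hz : IsIntegral R z) {u : R} (hu : IsUnit u)
    (hd : aeval z (derivative (minpoly K z)) = algebraMap R F u) {x : F} (hx : x ∈ K⟮z⟯)
    (hxR : IsIntegral R x) : x ∈ Algebra.adjoin R {z} := by
  have hzK : IsIntegral K z := hz.tower_top
  have hd0 : aeval z (derivative (minpoly K z)) ≠ 0 := by
    rw [hd]
    exact (hu.map (algebraMap R F)).ne_zero
  have hsep : IsSeparable K z := by
    refine (separable_iff_derivative_ne_zero (minpoly.irreducible hzK)).mpr fun h => hd0 ?_
    rw [h, map_zero]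
  have : Algebra.IsSeparable K K⟮z⟯ :=
    (IntermediateField.isSeparable_adjoin_simple_iff_isSeparable K F).mpr hsep
  have : FiniteDimensional K K⟮z⟯ := IntermediateField.adjoin.finiteDimensional hzK
  have : IsScalarTower R K⟮z⟯ F := IsScalarTower.of_algebraMap_eq fun r => rfl
  let y : K⟮z⟯ := IntermediateField.AdjoinSimple.gen K z
  have hy : Algebra.adjoin K {y} = ⊤ := by
    have := (IntermediateField.adjoin.powerBasis hzK).adjoin_gen_eq_top
    rwa [IntermediateField.adjoin.powerBasis_gen] at this
  have hinj : Function.Injective (algebraMap K⟮z⟯ F) := (algebraMap K⟮z⟯ F).injective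
  have hyR : IsIntegral R y := by
    refine (isIntegral_algHom_iff (IsScalarTower.toAlgHom R K⟮z⟯ F) hinj).mp ?_
    exact hz
  have hdy : aeval y (derivative (minpoly K y)) = algebraMap R K⟮z⟯ u := by
    apply hinj
    rw [← aeval_algebraMap_apply, ← IsScalarTower.algebraMap_apply R K⟮z⟯ F,
      IntermediateField.minpoly_gen]
    exact hd
  -- The trace dual of `R[z]` is `R[z]` divided by the derivative of the minimal polynomial at `z`,
  -- here a unit. Elements integral over the normal ring `R` lie in this dual because traces of
  -- integral elements lie in `R`.
  have hdual := traceForm_dualSubmodule_adjoin R K hy hyR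
  have hxL : IsIntegral R (⟨x, hx⟩ : K⟮z⟯) :=
    (isIntegral_algHom_iff (IsScalarTower.toAlgHom R K⟮z⟯ F) hinj).mp hxR
  have hmem : (⟨x, hx⟩ : K⟮z⟯) ∈ (Algebra.traceForm K K⟮z⟯).dualSubmodule
      (Subalgebra.toSubmodule (Algebra.adjoin R {y})) := by
    rw [LinearMap.BilinForm.mem_dualSubmodule]
    intro w hw
    rw [Algebra.traceForm_apply, Submodule.one_eq_range]
    have hwR : IsIntegral R w := by
      have := Algebra.IsIntegral.adjoin (R := R) (S := {y}) (by simpa using hyR)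
      exact (this.isIntegral (⟨w, hw⟩ : Algebra.adjoin R {y})).map (Algebra.adjoin R {y}).val
    obtain ⟨r, hr⟩ := IsIntegrallyClosed.isIntegral_iff.mp
      (Algebra.isIntegral_trace (L := K) (hxL.mul hwR))
    exact ⟨r, hr⟩
  rw [hdual, hdy] at hmem
  obtain ⟨w, hw, hwx⟩ := hmem
  obtain ⟨u, rfl⟩ := hu
  have hw' : (⟨x, hx⟩ : K⟮z⟯) ∈ Algebra.adjoin R {y} := by
    rw [← hwx]
    have hinv : (algebraMap R K⟮z⟯ (u : R))⁻¹ = algebraMap R K⟮z⟯ ((u⁻¹ : Rˣ) : R) := by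
      refine inv_eq_of_mul_eq_one_right ?_
      rw [← map_mul, Units.mul_inv, map_one]
    change (algebraMap R K⟮z⟯ (u : R))⁻¹ * w ∈ _
    rw [hinv]
    exact mul_mem (Subalgebra.algebraMap_mem _ _) hw
  have hmap : (IsScalarTower.toAlgHom R K⟮z⟯ F) ⟨x, hx⟩ ∈
      (Algebra.adjoin R {y}).map (IsScalarTower.toAlgHom R K⟮z⟯ F) := ⟨_, hw', rfl⟩
  rw [AlgHom.map_adjoin_singleton] at hmap
  exact hmap

variable {𝕜 F : Type*} [Field 𝕜] [Field F] [Algebra 𝕜 F]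

lemma isPrincipalIdealRing_adjoin_singleton (x : F) :
    IsPrincipalIdealRing (Algebra.adjoin 𝕜 {x}) := by
  rw [Algebra.adjoin_singleton_eq_range_aeval]
  exact IsPrincipalIdealRing.of_surjective (aeval (R := 𝕜) x).rangeRestrict
    (aeval (R := 𝕜) x).rangeRestrict_surjective

open IntermediateField.algebraAdjoinAdjoin in
lemma isIntegrallyClosed_adjoin_insert {S : Set F} {z : F}
    (hS : IsIntegrallyClosed (Algebra.adjoin 𝕜 S)) (hz : IsIntegral (Algebra.adjoin 𝕜 S) z)
    {c : 𝕜} (hc : c ≠ 0)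
    (hd : aeval z (derivative (minpoly (IntermediateField.adjoin 𝕜 S) z)) = algebraMap 𝕜 F c) :
    IsIntegrallyClosed (Algebra.adjoin 𝕜 (S ∪ {z})) := by
  rw [isIntegrallyClosed_iff (IntermediateField.adjoin 𝕜 (S ∪ {z}))]
  intro x hx
  have hx1 : IsIntegral (Algebra.adjoin 𝕜 (S ∪ {z})) (x : F) :=
    hx.map (IsScalarTower.toAlgHom (Algebra.adjoin 𝕜 (S ∪ {z}))
      (IntermediateField.adjoin 𝕜 (S ∪ {z})) F)
  have hxK : (x : F) ∈ (IntermediateField.adjoin 𝕜 S)⟮z⟯ := by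
    have : (x : F) ∈ ((IntermediateField.adjoin 𝕜 S)⟮z⟯).restrictScalars 𝕜 := by
      rw [IntermediateField.adjoin_adjoin_left]
      exact x.2
    exact this
  have hadj := Algebra.adjoin_union_eq_adjoin_adjoin 𝕜 S {z}
  have hx2 : IsIntegral (Algebra.adjoin (Algebra.adjoin 𝕜 S) {z}) (x : F) := by
    rw [hadj] at hx1
    exact hx1
  have := Algebra.IsIntegral.adjoin (R := Algebra.adjoin 𝕜 S) (S := {z}) (by simpa using hz)
  have hx3 : IsIntegral (Algebra.adjoin 𝕜 S) (x : F) := isIntegral_trans _ hx2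
  have hmem := mem_adjoin_of_isIntegral (R := Algebra.adjoin 𝕜 S)
    (K := IntermediateField.adjoin 𝕜 S) hz
    ((isUnit_iff_ne_zero.mpr hc).map (algebraMap 𝕜 (Algebra.adjoin 𝕜 S)))
    (by rw [hd, ← IsScalarTower.algebraMap_apply]) hxK hx3
  have hmem' : (x : F) ∈ Algebra.adjoin 𝕜 (S ∪ {z}) := by
    rw [hadj]
    exact hmem
  exact ⟨⟨x, hmem'⟩, Subtype.ext rfl⟩

end IntegralClosure

namespace Tower

open Polynomial

variable {p k : ℕ} {𝕜 F : Type*} [Field 𝕜] [Field F] [Algebra 𝕜 F] (T : Tower p k 𝕜 F)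

lemma linearCombination_d_mem {S : Type*} [SetLike S F] [AddSubmonoidClass S F]
    [SubmonoidClass S F] [SMulMemClass S 𝕜 F] (s : S) {i : Fin k} (h : ∀ j < i.succ, T.f j ∈ s) :
    Finsupp.linearCombination 𝕜 (monom T.f) (T.d i) ∈ s := by
  rw [Finsupp.linearCombination_apply, Finsupp.sum]
  refine sum_mem fun l hl => SMulMemClass.smul_mem _ (prod_mem fun j _ => ?_)
  rcases lt_or_ge j i.succ with hj | hj
  · exact pow_mem (h j hj) _
  · rw [(T.d_reduced i l hl).1 j hj, pow_zero]
    exact one_mem s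

lemma isIntegral_f [Fact p.Prime] (i : Fin k) :
    IsIntegral (Algebra.adjoin 𝕜 (T.f '' {j | j < i.succ})) (T.f i.succ) := by
  have hp : p.Prime := Fact.out
  set R := Algebra.adjoin 𝕜 (T.f '' {j | j < i.succ})
  have hD : Finsupp.linearCombination 𝕜 (monom T.f) (T.d i) ∈ R :=
    T.linearCombination_d_mem R fun j hj => Algebra.subset_adjoin ⟨j, hj, rfl⟩
  refine ⟨X ^ p ^ T.n i + (∑ j ∈ Finset.range (T.n i), C (algebraMap 𝕜 R (T.a i j)) * X ^ p ^ j
    - C ⟨_, hD⟩), monic_X_pow_add ?_, ?_⟩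
  · refine lt_of_le_of_lt (degree_sub_le _ _) (max_lt ?_ ?_)
    · refine lt_of_le_of_lt (degree_sum_le _ _) ((Finset.sup_lt_iff ?_).mpr fun j hj => ?_)
      · exact WithBot.bot_lt_coe _
      · refine lt_of_le_of_lt (degree_C_mul_X_pow_le _ _) ?_
        exact_mod_cast Nat.pow_lt_pow_right hp.one_lt (Finset.mem_range.mp hj)
    · refine lt_of_le_of_lt degree_C_le ?_
      exact_mod_cast pow_pos hp.pos _
  · have h := T.equation_eq i
    simp only [Algebra.smul_def] at h
    simp only [eval₂_add, eval₂_sub, eval₂_pow, eval₂_X, eval₂_finsetSum, eval₂_mul, eval₂_C,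
      ← IsScalarTower.algebraMap_apply]
    rw [← add_sub_assoc, h]
    exact sub_self _

lemma aeval_derivative_minpoly [CharP 𝕜 p] (i : Fin k) :
    aeval (T.f i.succ) (derivative (minpoly (stepField 𝕜 T.f i) (T.f i.succ))) =
      algebraMap 𝕜 F (T.a i 0) := by
  have := charP_of_injective_algebraMap (algebraMap 𝕜 F).injective p
  have hz : ∀ j ≠ 0, ((p ^ j : ℕ) : F) = 0 := fun j hj => by
    rw [Nat.cast_pow, CharP.cast_eq_zero, zero_pow hj]
  rw [← eval_map_algebraMap, ← derivative_map, T.equation i, stepPolynomial]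
  simp only [derivative_sub, derivative_add, derivative_X_pow, derivative_C, derivative_sum,
    derivative_C_mul, eval_add, eval_mul, eval_pow, eval_X, eval_C,
    eval_finsetSum, hz _ (T.n_pos i).ne', zero_mul, zero_add, sub_zero]
  rw [Finset.sum_eq_single_of_mem 0 (Finset.mem_range.mpr (T.n_pos i))]
  · simp
  · intro j _ hj
    simp [hz j hj]

/-- The ring `𝕜[f₀, …, f_k]` is normal. -/
lemma isIntegrallyClosed_adjoin [Fact p.Prime] [CharP 𝕜 p] {D : Derivation 𝕜 F F}
    (hD : D (T.f 0) = 1) : IsIntegrallyClosed (Algebra.adjoin 𝕜 (Set.range T.f)) := by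
  have key : ∀ m : Fin (k + 1), IsIntegrallyClosed (Algebra.adjoin 𝕜 (T.f '' {j | j ≤ m})) := by
    intro m
    induction m using Fin.induction with
    | zero =>
      have h0 : T.f '' {j | j ≤ 0} = {T.f 0} := by simp
      rw [h0]
      have := isPrincipalIdealRing_adjoin_singleton (𝕜 := 𝕜) (T.f 0)
      infer_instance
    | succ i ih =>
      have h1 : {j : Fin (k + 1) | j ≤ i.castSucc} = {j | j < i.succ} := by
        ext j
        exact Fin.le_castSucc_iff
      have h2 : T.f '' {j | j ≤ i.succ} = T.f '' {j | j < i.succ} ∪ {T.f i.succ} := by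
        rw [← Set.image_singleton, ← Set.image_union]
        congr 1
        ext j
        exact le_iff_lt_or_eq (a := j)
      rw [h1] at ih
      rw [h2]
      exact isIntegrallyClosed_adjoin_insert ih (T.isIntegral_f i) (a_zero_ne_zero hD i)
        (T.aeval_derivative_minpoly i)
  have h := key (Fin.last k)
  have hr : T.f '' {j | j ≤ Fin.last k} = Set.range T.f := by
    rw [← Set.image_univ]
    congr 1
    ext j
    exact iff_of_true (Fin.le_last j) trivial
  rwa [hr] at h

end Tower

end HKG

namespace HKG

/-! ### Functions and derivations at the places other than `P`. -/

section Localization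

/-- A valuation ring of the fraction field of a Dedekind domain `C` that contains `C` is a
localization of `C`. -/
lemma exists_mul_eq_of_isDedekindDomain {C F : Type*} [CommRing C] [IsDedekindDomain C] [Field F]
    [Algebra C F] [IsFractionRing C F] {O : ValuationSubring F} (hC : ∀ c : C, algebraMap C F c ∈ O)
    {x : F} (hx : x ∈ O) :
    ∃ b s : C, O.valuation (algebraMap C F s) = 1 ∧ x * algebraMap C F s = algebraMap C F b := by
  have hle : ∀ c : C, O.valuation (algebraMap C F c) ≤ 1 := fun c =>
    (O.valuation_le_one_iff _).mpr (hC c)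
  let q : Ideal C := {
    carrier := {c | O.valuation (algebraMap C F c) < 1}
    add_mem' := fun {a b} ha hb => by
      change O.valuation _ < 1
      rw [map_add]
      exact Valuation.map_add_lt _ ha hb
    zero_mem' := by
      change O.valuation _ < 1
      simp
    smul_mem' := fun c a ha => by
      change O.valuation _ < 1
      rw [smul_eq_mul, map_mul, map_mul]
      exact lt_of_le_of_lt (mul_le_of_le_one_left' (hle c)) ha }
  have hq : ∀ c, c ∉ q ↔ O.valuation (algebraMap C F c) = 1 := fun c =>
    ⟨fun h => le_antisymm (hle c) (not_lt.mp h), fun h h' => h'.ne h⟩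
  have hprime : q.IsPrime := by
    refine Ideal.isPrime_iff.mpr ⟨fun h => ?_, fun {a b} hab => ?_⟩
    · refine (hq 1).mpr (by simp) ?_
      rw [h]
      trivial
    · by_contra! hne
      refine (hq (a * b)).mpr ?_ hab
      rw [map_mul, map_mul, (hq a).mp hne.1, (hq b).mp hne.2, one_mul]
  obtain ⟨b, s, hs, rfl⟩ := IsFractionRing.div_surjective (A := C) x
  have hs0 : s ≠ 0 := nonZeroDivisors.ne_zero hs
  have hsF : algebraMap C F s ≠ 0 := by
    simpa using hs0
  by_cases hbot : q = ⊥
  · exact ⟨b, s, (hq s).mp fun h => hs0 (by rwa [hbot] at h), div_mul_cancel₀ _ hsF⟩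
  have := IsLocalization.AtPrime.isDiscreteValuationRing_of_dedekind_domain C hbot
    (Localization.AtPrime q)
  have hinj : Function.Injective (algebraMap C (Localization.AtPrime q)) :=
    IsLocalization.injective _ q.primeCompl_le_nonZeroDivisors
  have hclear : ∀ a c : C, algebraMap C (Localization.AtPrime q) a ∣
      algebraMap C (Localization.AtPrime q) c → ∃ e u : C, u ∉ q ∧ a * e = c * u := by
    rintro a c ⟨z, hz⟩
    obtain ⟨e, u, rfl⟩ := IsLocalization.exists_mk'_eq q.primeCompl z
    refine ⟨e, u, u.2, hinj ?_⟩
    rw [map_mul, map_mul, hz, mul_assoc, IsLocalization.mk'_spec]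
  -- The localization at the center `q` of `O` is a valuation ring, so it contains `x` or `x⁻¹`. In
  -- the second case `x * e = u` with `u` a unit of `O`, and `x ∈ O` forces `e` to be a unit as
  -- well.
  rcases ValuationRing.dvd_total (algebraMap C (Localization.AtPrime q) s)
    (algebraMap C (Localization.AtPrime q) b) with h | h
  · obtain ⟨e, u, hu, h⟩ := hclear _ _ h
    refine ⟨e, u, (hq u).mp hu, ?_⟩
    rw [div_mul_eq_mul_div, ← map_mul, ← h, map_mul, mul_div_cancel_left₀ _ hsF]
  · obtain ⟨e, u, hu, h⟩ := hclear _ _ h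
    have hxe : algebraMap C F b / algebraMap C F s * algebraMap C F e = algebraMap C F u := by
      rw [div_mul_eq_mul_div, ← map_mul, h, map_mul, mul_div_cancel_left₀ _ hsF]
    refine ⟨u, e, le_antisymm (hle e) ?_, hxe⟩
    rw [← (hq u).mp hu, ← hxe, map_mul]
    exact mul_le_of_le_one_left' ((O.valuation_le_one_iff _).mpr hx)

open IntermediateField.algebraAdjoinAdjoin in
lemma isDedekindDomain_integralClosure_adjoin {𝕜 F : Type*} [Field 𝕜] [Field F] [Algebra 𝕜 F]
    (x : F) [FiniteDimensional 𝕜⟮x⟯ F] [Algebra.IsSeparable 𝕜⟮x⟯ F] :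
    IsDedekindDomain (integralClosure (Algebra.adjoin 𝕜 {x}) F) := by
  have := isPrincipalIdealRing_adjoin_singleton (𝕜 := 𝕜) x
  exact integralClosure.isDedekindDomain (Algebra.adjoin 𝕜 {x}) 𝕜⟮x⟯ F

open IntermediateField.algebraAdjoinAdjoin in
lemma isFractionRing_integralClosure_adjoin {𝕜 F : Type*} [Field 𝕜] [Field F] [Algebra 𝕜 F]
    (x : F) [FiniteDimensional 𝕜⟮x⟯ F] :
    IsFractionRing (integralClosure (Algebra.adjoin 𝕜 {x}) F) F :=
  integralClosure.isFractionRing_of_finite_extension 𝕜⟮x⟯ F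

lemma mem_of_isIntegral_of_le {𝕜 F : Type*} [Field 𝕜] [Field F] [Algebra 𝕜 F]
    {A R : Subalgebra 𝕜 F} (hAR : A ≤ R) [IsIntegrallyClosed R] [IsFractionRing R F] {x : F}
    (hx : IsIntegral A x) : x ∈ R := by
  obtain ⟨q, hq, h⟩ := hx
  have hxR : IsIntegral R x := ⟨q.map (Subalgebra.inclusion hAR).toRingHom, hq.map _, by
    rw [Polynomial.eval₂_map]
    exact h⟩
  obtain ⟨r, hr⟩ := IsIntegrallyClosed.isIntegral_iff.mp hxR
  rw [← hr]
  exact r.2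

end Localization

namespace Tower

variable {p k : ℕ} {𝕜 F : Type*} [Field 𝕜] [Field F] [Algebra 𝕜 F] (T : Tower p k 𝕜 F)
  {D : Derivation 𝕜 F F}

lemma derivation_mem_of_mem_adjoin {S : Set F} {B : Subalgebra 𝕜 F} (hS : ∀ s ∈ S, s ∈ B)
    (hD : ∀ s ∈ S, D s ∈ B) {x : F} (hx : x ∈ Algebra.adjoin 𝕜 S) : D x ∈ B := by
  have hle : Algebra.adjoin 𝕜 S ≤ B := Algebra.adjoin_le hS
  induction hx using Algebra.adjoin_induction with
  | mem x hx => exact hD x hx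
  | algebraMap c => rw [Derivation.map_algebraMap]; exact zero_mem B
  | add x y _ _ hx hy => rw [map_add]; exact add_mem hx hy
  | mul x y hxS hyS hx hy =>
    rw [Derivation.leibniz]
    exact add_mem (mul_mem (hle hxS) hy) (mul_mem (hle hyS) hx)

/-- The derivation `d / df₀` preserves `𝕜[f₀, …, f_k]`. -/
lemma derivation_mem_adjoin [Fact p.Prime] [CharP 𝕜 p] (hD : D (T.f 0) = 1) {x : F}
    (hx : x ∈ Algebra.adjoin 𝕜 (Set.range T.f)) :
    D x ∈ Algebra.adjoin 𝕜 (Set.range T.f) := by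
  have key : ∀ j, D (T.f j) ∈ Algebra.adjoin 𝕜 (Set.range T.f) := by
    intro j
    induction j using WellFoundedLT.induction with
    | ind j ih =>
    induction j using Fin.cases with
    | zero => rw [hD]; exact one_mem _
    | succ i =>
      have ha := a_zero_ne_zero hD i
      have hmem : T.a i 0 • D (T.f i.succ) ∈ Algebra.adjoin 𝕜 (Set.range T.f) := by
        rw [T.smul_derivation_eq D i]
        refine derivation_mem_of_mem_adjoin (S := T.f '' {j | j < i.succ}) ?_ ?_
          (T.linearCombination_d_mem _ fun j hj => Algebra.subset_adjoin ⟨j, hj, rfl⟩)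
        · rintro _ ⟨j, -, rfl⟩
          exact T.f_mem_adjoin j
        · rintro _ ⟨j, hj, rfl⟩
          exact ih j hj
      rw [← inv_smul_smul₀ ha (D (T.f i.succ))]
      exact Subalgebra.smul_mem _ hmem _
  refine derivation_mem_of_mem_adjoin (fun s hs => Algebra.subset_adjoin hs) ?_ hx
  rintro _ ⟨j, rfl⟩
  exact key j

lemma adjoin_le_of_isPlace {Q : ValuationSubring F} (hQ : IsPlace 𝕜 Q) (hQP : Q ≠ T.P) {x : F}
    (hx : x ∈ Algebra.adjoin 𝕜 (Set.range T.f)) : x ∈ Q := by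
  induction hx using Algebra.adjoin_induction with
  | mem x hx => obtain ⟨j, rfl⟩ := hx; exact T.regular j Q hQ hQP
  | algebraMap c => exact hQ.contains_constants c
  | add x y _ _ hx hy => exact Q.add_mem _ _ hx hy
  | mul x y _ _ hx hy => exact Q.mul_mem _ _ hx hy

lemma isFractionRing_adjoin : IsFractionRing (Algebra.adjoin 𝕜 (Set.range T.f)) F :=
  IsFractionRing.of_field _ _ fun x => by
    obtain ⟨y, hy, s, hs, rfl⟩ := T.exists_eq_div x
    exact ⟨⟨y, hy⟩, ⟨s, hs⟩, rfl⟩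

/-- A function that is regular outside `P` belongs to `𝕜[f₀, …, f_k]`. -/
lemma mem_adjoin_of_forall_mem [Fact p.Prime] [CharP 𝕜 p] (hD : D (T.f 0) = 1) {x : F}
    (hx : ∀ Q : ValuationSubring F, IsPlace 𝕜 Q → Q ≠ T.P → x ∈ Q) :
    x ∈ Algebra.adjoin 𝕜 (Set.range T.f) := by
  have := T.isIntegrallyClosed_adjoin hD
  have := T.isFractionRing_adjoin
  have : IsIntegrallyClosedIn (Algebra.adjoin 𝕜 (Set.range T.f)).toSubring F :=
    (isIntegrallyClosed_iff_isIntegrallyClosedIn (R := Algebra.adjoin 𝕜 (Set.range T.f)) F).mp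
      inferInstance
  by_contra hxR
  -- A normal ring is the intersection of the valuation rings that contain it. Such a ring `V` is a
  -- place, and it is not `P` because `f₀` has a pole at `P`.
  obtain ⟨V, hRV, hxV⟩ := Subring.exists_le_valuationSubring_of_isIntegrallyClosedIn
    (R := (Algebra.adjoin 𝕜 (Set.range T.f)).toSubring) (x := x) hxR
  have hV : IsPlace 𝕜 V :=
    ⟨fun c => hRV (Subalgebra.algebraMap_mem _ c), fun h => hxV (h ▸ ValuationSubring.mem_top x)⟩
  refine hxV (hx V hV ?_)
  rintro rfl
  obtain ⟨γ, hγ, hf, -⟩ := T.exists_valuation_eq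
  have h1 := (T.P.valuation_le_one_iff _).mpr (hRV (T.f_mem_adjoin 0))
  rw [hf] at h1
  exact not_lt.mpr h1 (one_lt_pow₀ hγ (weight_pos Fact.out T.b_coprime 0).ne')

/-- The local ring of a place `Q ≠ P` is a localization of `𝕜[f₀, …, f_k]`. -/
lemma exists_mul_eq_of_isPlace [Fact p.Prime] [CharP 𝕜 p] (hD : D (T.f 0) = 1)
    {Q : ValuationSubring F} (hQ : IsPlace 𝕜 Q) (hQP : Q ≠ T.P) {x : F} (hx : x ∈ Q) :
    ∃ b ∈ Algebra.adjoin 𝕜 (Set.range T.f), ∃ s ∈ Algebra.adjoin 𝕜 (Set.range T.f),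
      Q.valuation s = 1 ∧ x * s = b := by
  have := T.isIntegrallyClosed_adjoin hD
  have := T.isFractionRing_adjoin
  have := T.cover.finite
  have := T.cover.galois
  -- The integral closure of `𝕜[f₀]` is Dedekind since `F` is finite separable over `𝕜(f₀)`, and it
  -- lies in the normal ring `𝕜[f₀, …, f_k]`; fractions over it therefore suffice.
  have := isDedekindDomain_integralClosure_adjoin (𝕜 := 𝕜) (T.f 0)
  have := isFractionRing_integralClosure_adjoin (𝕜 := 𝕜) (T.f 0)
  have hC : ∀ c : integralClosure (Algebra.adjoin 𝕜 {T.f 0}) F,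
      algebraMap _ F c ∈ Algebra.adjoin 𝕜 (Set.range T.f) := fun c =>
    mem_of_isIntegral_of_le (Algebra.adjoin_mono (Set.singleton_subset_iff.mpr (Set.mem_range_self 0))) c.2
  obtain ⟨b, s, hs, hxs⟩ := exists_mul_eq_of_isDedekindDomain
    (C := integralClosure (Algebra.adjoin 𝕜 {T.f 0}) F)
    (fun c => T.adjoin_le_of_isPlace hQ hQP (hC c)) hx
  exact ⟨_, hC b, _, hC s, hs, hxs⟩

/-- The derivation `d / df₀` preserves the functions that are regular at a place `Q ≠ P`. -/
lemma derivation_mem_of_isPlace [Fact p.Prime] [CharP 𝕜 p] (hD : D (T.f 0) = 1)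
    {Q : ValuationSubring F} (hQ : IsPlace 𝕜 Q) (hQP : Q ≠ T.P) {x : F} (hx : x ∈ Q) :
    D x ∈ Q := by
  obtain ⟨b, hb, s, hsR, hs, hxs⟩ := T.exists_mul_eq_of_isPlace hD hQ hQP hx
  -- Quotient rule with a denominator `s` that is a unit at `Q`, so regularity of `s * D x` is
  -- regularity of `D x`.
  have hDx : s * D x = D b - x * D s := by
    rw [← hxs, Derivation.leibniz, smul_eq_mul, smul_eq_mul]
    ring
  have hmem : ∀ c ∈ Algebra.adjoin 𝕜 (Set.range T.f), D c ∈ Q := fun c hc =>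
    T.adjoin_le_of_isPlace hQ hQP (T.derivation_mem_adjoin hD hc)
  have h2 : s * D x ∈ Q := by
    rw [hDx]
    exact sub_mem (hmem b hb) (Q.mul_mem _ _ hx (hmem s hsR))
  rwa [← Q.valuation_le_one_iff, map_mul, hs, one_mul, Q.valuation_le_one_iff] at h2

end Tower

end HKG

namespace HKG

/-! ### Holomorphic differentials, the genus bound and the quadratic relations. -/

section Differentials

variable {𝕜 F : Type*} [Field 𝕜] [Field F] [Algebra 𝕜 F]

lemma dd_eq_smul {δ : Ω[F⁄𝕜] →ₗ[F] F} {x : F} (hδ : ∀ ω, ω = δ ω • KaehlerDifferential.D 𝕜 F x)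
    (t : F) : dd 𝕜 t = δ (KaehlerDifferential.D 𝕜 F t) • dd 𝕜 x := by
  unfold dd
  rw [← map_smul, ← hδ]

lemma coordinate_mem_of_mem_span {δ : Ω[F⁄𝕜] →ₗ[F] F} {O : ValuationSubring F} {ω : Ω[F⁄𝕜]}
    (hω : ω ∈ Submodule.span 𝕜 {ω | ∃ a ∈ O, ∃ x ∈ O, ω = a • KaehlerDifferential.D 𝕜 F x})
    {M : Submodule 𝕜 F}
    (h : ∀ a ∈ O, ∀ x ∈ O, a * δ (KaehlerDifferential.D 𝕜 F x) ∈ M) : δ ω ∈ M := by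
  refine (Submodule.span_le (p := M.comap (δ.restrictScalars 𝕜))).mpr ?_ hω
  rintro _ ⟨a, ha, x, hx, rfl⟩
  change δ (a • KaehlerDifferential.D 𝕜 F x) ∈ M
  rw [map_smul, smul_eq_mul]
  exact h a ha x hx

end Differentials

namespace Tower

variable {p k : ℕ} {𝕜 F : Type*} [Field 𝕜] [Field F] [Algebra 𝕜 F] (T : Tower p k 𝕜 F)

lemma exists_coordinate : ∃ δ : Ω[F⁄𝕜] →ₗ[F] F, δ (KaehlerDifferential.D 𝕜 F (T.f 0)) = 1 ∧
    ∀ ω, ω = δ ω • KaehlerDifferential.D 𝕜 F (T.f 0) := by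
  have := T.cover.galois
  exact exists_coordinate_of_transcendental T.cover.transcendental

/-- The elements of `F` with valuation at most `κ` at `P`. -/
def poleSubmodule (κ : T.P.ValueGroup) : Submodule 𝕜 F where
  carrier := {x | T.P.valuation x ≤ κ}
  add_mem' := fun {x y} hx hy => by
    change T.P.valuation (x + y) ≤ κ
    exact Valuation.map_add_le _ hx hy
  zero_mem' := by simp
  smul_mem' := fun c x hx => by
    change T.P.valuation (c • x) ≤ κ
    rw [Algebra.smul_def, map_mul]
    exact (mul_le_of_le_one_left' (T.cover.place.valuation_algebraMap_le c)).trans hx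

/-- The functions that are regular at the place `Q`. -/
def _root_.HKG.IsPlace.toSubmodule {Q : ValuationSubring F} (hQ : IsPlace 𝕜 Q) :
    Submodule 𝕜 F where
  carrier := Q
  add_mem' := Q.add_mem _ _
  zero_mem' := Q.zero_mem
  smul_mem' := fun c x hx => by
    rw [Algebra.smul_def]
    exact Q.mul_mem _ _ (hQ.contains_constants c) hx

/-- A holomorphic differential is a combination of the `f_L df₀` with `L` reduced and `‖L‖` less
than the Frobenius number. -/
lemma coordinate_mem_span [Fact p.Prime] [CharP 𝕜 p] {δ : Ω[F⁄𝕜] →ₗ[F] F}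
    (hδ : δ (KaehlerDifferential.D 𝕜 F (T.f 0)) = 1) {ω : Ω[F⁄𝕜]}
    (hω : ω ∈ holomorphicDifferentials 𝕜 F) :
    δ ω ∈ Submodule.span 𝕜 (monom T.f '' {L | Reduced p T.n L ∧
      (wnorm p T.n T.b L : ℤ) < frobeniusNumber p T.n T.b}) := by
  let D : Derivation 𝕜 F F := δ.compDer (KaehlerDifferential.D 𝕜 F)
  have hD : D (T.f 0) = 1 := hδ
  obtain ⟨γ, hγ, hf, hγt⟩ := T.exists_valuation_eq
  have hω' : ∀ Q : ValuationSubring F, IsPlace 𝕜 Q → ω ∈ Submodule.span 𝕜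
      {ω | ∃ a ∈ Q, ∃ x ∈ Q, ω = a • KaehlerDifferential.D 𝕜 F x} := by
    simpa only [holomorphicDifferentials, Submodule.mem_iInf] using hω
  have hR : δ ω ∈ Algebra.adjoin 𝕜 (Set.range T.f) := T.mem_adjoin_of_forall_mem hD
    fun Q hQ hQP => coordinate_mem_of_mem_span (M := hQ.toSubmodule) (hω' Q hQ)
      fun a ha x hx => Q.mul_mem _ _ ha (T.derivation_mem_of_isPlace hD hQ hQP hx)
  have hP : δ ω ∈ T.poleSubmodule (γ ^ (frobeniusNumber p T.n T.b - 1)) :=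
    coordinate_mem_of_mem_span (hω' T.P T.cover.place) fun a ha x hx => by
      change T.P.valuation (a * D x) ≤ _
      rw [map_mul]
      exact (mul_le_of_le_one_left' ((T.P.valuation_le_one_iff a).mpr ha)).trans
        (valuation_derivation_le_of_mem hγ hf hγt hD hx)
  obtain ⟨d, hd, h⟩ := T.exists_linearCombination hR
  rw [← h, Finsupp.linearCombination_apply, Finsupp.sum]
  refine sum_mem fun l hl => Submodule.smul_mem _ _ (Submodule.subset_span ⟨l, ⟨hd l hl, ?_⟩, rfl⟩)
  -- Reduced monomials do not cancel at `P`, so the bound `N - 1` on the pole of the coordinate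
  -- holds for each monomial that occurs in it.
  have hle := pow_wnorm_le_valuation hγ hf hd hl
  rw [h] at hle
  have := hle.trans hP
  rw [← zpow_natCast, zpow_le_zpow_iff_right₀ hγ] at this
  omega

/-- The inequality `2 g - 2 ≤ deg div (df₀)`. -/
lemma genus_le [Fact p.Prime] [CharP 𝕜 p] :
    genus 𝕜 F = 0 ∨ 2 * (genus 𝕜 F : ℤ) ≤ frobeniusNumber p T.n T.b + 1 := by
  classical
  obtain ⟨δ, hδ1, hδ⟩ := T.exists_coordinate
  obtain ⟨E, hE, hcard⟩ := exists_finset_reduced (n := T.n) (b := T.b) Fact.out T.b_coprime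
  have hset : {L | Reduced p T.n L ∧ (wnorm p T.n T.b L : ℤ) < frobeniusNumber p T.n T.b} = E := by
    ext L
    exact (hE L).symm
  let ψ : holomorphicDifferentials 𝕜 F →ₗ[𝕜] F :=
    (δ.restrictScalars 𝕜).comp (holomorphicDifferentials 𝕜 F).subtype
  have hψ : Function.Injective ψ := fun ω η h => by
    apply Subtype.ext
    rw [hδ ω, hδ η]
    exact congrArg (· • KaehlerDifferential.D 𝕜 F (T.f 0)) h
  have hrange : LinearMap.range ψ ≤ Submodule.span 𝕜 (E.image (monom T.f) : Finset F) := by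
    rintro _ ⟨ω, rfl⟩
    rw [Finset.coe_image, ← hset]
    exact T.coordinate_mem_span hδ1 ω.2
  have hle : genus 𝕜 F ≤ E.card := by
    rw [genus, ← LinearMap.finrank_range_of_inj hψ]
    exact (Submodule.finrank_mono hrange).trans
      ((finrank_span_finset_le_card _).trans Finset.card_image_le)
  omega

variable {T}

lemma diff_mem_holomorphicDifferentials [Fact p.Prime] [CharP 𝕜 p] {L : Fin (k + 1) → ℕ}
    (hL : (T.nrm L : ℤ) ≤ frobeniusNumber p T.n T.b - 1) :
    T.diff L ∈ holomorphicDifferentials 𝕜 F := by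
  rw [holomorphicDifferentials, Submodule.mem_iInf]
  intro Q
  rw [Submodule.mem_iInf]
  intro hQ
  apply Submodule.subset_span
  by_cases hQP : Q = T.P
  · subst hQP
    obtain ⟨δ, hδ1, hδ⟩ := T.exists_coordinate
    obtain ⟨γ, hγ, hf, -⟩ := T.exists_valuation_eq
    have hγ0 : γ ≠ 0 := (zero_lt_one.trans hγ).ne'
    obtain ⟨t, ht, hv⟩ := exists_valuation_derivation_eq
      (D := δ.compDer (KaehlerDifferential.D 𝕜 F)) hγ hf hδ1
    change T.P.valuation (δ (KaehlerDifferential.D 𝕜 F t)) = _ at hv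
    set u := δ (KaehlerDifferential.D 𝕜 F t) with hu
    have hu0 : u ≠ 0 := fun h => by
      rw [h, map_zero] at hv
      exact zpow_ne_zero _ hγ0 hv.symm
    -- With `u = dt/df₀` of pole order `N - 1`, `f_L df₀ = (f_L / u) dt`, and `f_L / u` is regular
    -- at `P` exactly because `‖L‖ ≤ N - 1`.
    refine ⟨monom T.f L / u, ?_, t, ht, ?_⟩
    · rw [← T.P.valuation_le_one_iff, map_div₀, hv, valuation_monom hf,
        div_le_one₀ (zpow_pos (zero_lt_one.trans hγ) _), ← zpow_natCast]
      exact zpow_le_zpow_right₀ hγ.le hL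
    · rw [diff, hδ (KaehlerDifferential.D 𝕜 F t), ← hu, smul_smul, div_mul_cancel₀ _ hu0]
  · exact ⟨monom T.f L, T.monom_mem Q fun j => T.regular j Q hQ hQP, T.f 0,
      T.regular 0 Q hQ hQP, rfl⟩

lemma quadDiff_mem_holomorphicQuadraticDifferentials [Fact p.Prime] [CharP 𝕜 p]
    {u : Fin (k + 1) → ℕ} (hL : (T.nrm u : ℤ) ≤ 2 * (frobeniusNumber p T.n T.b - 1)) :
    T.quadDiff u ∈ holomorphicQuadraticDifferentials 𝕜 F := by
  rw [holomorphicQuadraticDifferentials, Submodule.mem_iInf]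
  intro Q
  rw [Submodule.mem_iInf]
  intro hQ
  apply Submodule.subset_span
  by_cases hQP : Q = T.P
  · subst hQP
    obtain ⟨δ, hδ1, hδ⟩ := T.exists_coordinate
    obtain ⟨γ, hγ, hf, -⟩ := T.exists_valuation_eq
    have hγ0 : γ ≠ 0 := (zero_lt_one.trans hγ).ne'
    obtain ⟨t, ht, hv⟩ := exists_valuation_derivation_eq
      (D := δ.compDer (KaehlerDifferential.D 𝕜 F)) hγ hf hδ1
    change T.P.valuation (δ (KaehlerDifferential.D 𝕜 F t)) = _ at hv
    have hdd := dd_eq_smul hδ t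
    set w := δ (KaehlerDifferential.D 𝕜 F t)
    have hw0 : w ≠ 0 := fun h => by
      rw [h, map_zero] at hv
      exact zpow_ne_zero _ hγ0 hv.symm
    refine ⟨monom T.f u / w ^ 2, ?_, t, ht, t, ht, ?_⟩
    · rw [← T.P.valuation_le_one_iff, map_div₀, map_pow, hv, valuation_monom hf,
        div_le_one₀ (pow_pos (zpow_pos (zero_lt_one.trans hγ) _) _), ← zpow_natCast, ← zpow_natCast,
        ← zpow_mul, mul_comm (_ - 1)]
      exact zpow_le_zpow_right₀ hγ.le hL
    · rw [quadDiff, hdd, ← sq, smul_pow, smul_smul, div_mul_cancel₀ _ (pow_ne_zero _ hw0)]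
  · refine ⟨monom T.f u, T.monom_mem Q fun j => T.regular j Q hQ hQP, T.f 0,
      T.regular 0 Q hQ hQP, T.f 0, T.regular 0 Q hQ hQP, ?_⟩
    rw [quadDiff, sq]

/-- `Dᵢ` has pole order `p ^ nᵢ m̄ᵢ`, and reduced monomials cannot cancel, so none of its monomials
has a larger pole. The truncated sum in `G_{v,i}` is thus all of `Dᵢ`. -/
lemma lambdas_eq_support [Fact p.Prime] (i : Fin k) : T.lambdas i = (T.d i).support := by
  refine Finset.filter_true_of_mem fun l hl => ?_
  obtain ⟨γ, hγ, hf, -⟩ := T.exists_valuation_eq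
  have h := pow_wnorm_le_valuation hγ hf (fun l hl => reduced_of_mem_support hl) hl
  rw [valuation_linearCombination_d hγ hf] at h
  exact (pow_le_pow_iff_right₀ hγ).mp h

lemma nrm_le_of_mem_terms [Fact p.Prime] {v u : Fin (k + 1) → ℕ} {i : Fin k}
    (hu : u ∈ T.terms v i) : T.nrm u ≤ T.nrm (T.gamma v i 0) := by
  have hp : p.Prime := Fact.out
  simp only [nrm, gamma, wnorm_add, wnorm_single, Nat.sub_zero]
  rcases hu with ⟨ν, -, rfl⟩ | ⟨l, hl, rfl⟩
  · rw [gamma, wnorm_add, wnorm_single]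
    gcongr
    · exact hp.one_le
    · exact Nat.sub_le _ _
  · rw [beta, wnorm_add, add_comm]
    exact Nat.add_le_add_left (Finset.mem_filter.mp hl).2 _

lemma canonicalMap_G_eq_zero [Fact p.Prime] {v : Fin (k + 1) → ℕ} {i : Fin k}
    {W : (Fin (k + 1) → ℕ) → SymH 𝕜 F} (hW : ∀ u ∈ T.terms v i, T.Represents u (W u)) :
    canonicalMap 𝕜 F (T.G v i W) = 0 := by
  have hγ : ∀ ν ≤ T.n i, canonicalMap 𝕜 F (W (T.gamma v i ν)) =
      (monom T.f v * T.f i.succ ^ p ^ (T.n i - ν)) • dd 𝕜 (T.f 0) ^ 2 := fun ν hν => by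
    rw [(hW _ (Or.inl ⟨ν, hν, rfl⟩)).2, quadDiff, gamma, monom_add, monom_single]
  have hβ : ∀ l ∈ T.lambdas i, canonicalMap 𝕜 F (W (beta v l)) =
      (monom T.f v * monom T.f l) • dd 𝕜 (T.f 0) ^ 2 := fun l hl => by
    rw [(hW _ (Or.inr ⟨l, hl, rfl⟩)).2, quadDiff, beta, monom_add, mul_comm]
  have hsum : ∑ ν ∈ Finset.Icc 1 (T.n i),
      T.a i (T.n i - ν) • canonicalMap 𝕜 F (W (T.gamma v i ν)) =
      (monom T.f v * ∑ j ∈ Finset.range (T.n i), T.a i j • T.f i.succ ^ p ^ j) •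
        dd 𝕜 (T.f 0) ^ 2 := by
    rw [Finset.mul_sum, Finset.sum_smul]
    refine Finset.sum_bij' (fun ν _ => T.n i - ν) (fun j _ => T.n i - j) ?_ ?_ ?_ ?_ ?_
    · intro ν hν
      rw [Finset.mem_Icc] at hν
      rw [Finset.mem_range]
      omega
    · intro j hj
      rw [Finset.mem_range] at hj
      rw [Finset.mem_Icc]
      omega
    · intro ν hν
      rw [Finset.mem_Icc] at hν
      omega
    · intro j hj
      rw [Finset.mem_range] at hj
      omega
    · intro ν hν
      rw [hγ ν (Finset.mem_Icc.mp hν).2, mul_smul_comm, smul_assoc]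
  rw [G, map_sub, map_add, map_sum, map_sum]
  simp only [map_smul]
  rw [hsum, hγ 0 (Nat.zero_le _), Nat.sub_zero, ← add_smul, ← mul_add, T.equation_eq i,
    Finsupp.linearCombination_apply, Finsupp.sum, ← lambdas_eq_support, Finset.mul_sum,
    Finset.sum_smul, sub_eq_zero]
  refine Finset.sum_congr rfl fun l hl => ?_
  rw [hβ l hl, mul_smul_comm, smul_assoc]

lemma represents_mul (L K : Fin (k + 1) → ℕ) (hL : T.diff L ∈ holomorphicDifferentials 𝕜 F)
    (hK : T.diff K ∈ holomorphicDifferentials 𝕜 F) :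
    T.Represents (L + K)
      (SymmetricAlgebra.ι 𝕜 (holomorphicDifferentials 𝕜 F) ⟨T.diff L, hL⟩ *
        SymmetricAlgebra.ι 𝕜 (holomorphicDifferentials 𝕜 F) ⟨T.diff K, hK⟩) := by
  have hφ : ∀ (M : Fin (k + 1) → ℕ) (hM : T.diff M ∈ holomorphicDifferentials 𝕜 F),
      canonicalMap 𝕜 F (SymmetricAlgebra.ι 𝕜 (holomorphicDifferentials 𝕜 F) ⟨T.diff M, hM⟩) =
        monom T.f M • dd 𝕜 (T.f 0) := by
    intro M hM
    rw [canonicalMap, SymmetricAlgebra.lift_ι_apply]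
    change SymmetricAlgebra.ι F (Ω[F⁄𝕜]) (T.diff M) = _
    rw [diff, map_smul, dd]
  refine ⟨?_, ?_⟩
  · rw [Sym2H, sq]
    exact Submodule.mul_mem_mul ⟨_, rfl⟩ ⟨_, rfl⟩
  · rw [map_mul, hφ, hφ, quadDiff, monom_add, smul_mul_smul_comm, sq]

end Tower

end HKG

end

theorem proposition4p4 {p k : ℕ} [Fact p.Prime] {𝕜 F : Type*} [Field 𝕜] [IsAlgClosed 𝕜]
    [CharP 𝕜 p] [Field F] [Algebra 𝕜 F] (T : HKG.Tower p k 𝕜 F) :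
    -- the differentials `ω_L = f_L df₀`, `L ∈ 𝐀`, are holomorphic, and `ω_L ω_K` represents
    -- the quadratic differential `f_{L+K} df₀^{⊗ 2}`
    (∃ hA : ∀ L ∈ T.A, T.diff L ∈ HKG.holomorphicDifferentials 𝕜 F,
      ∀ (L K : Fin (k + 1) → ℕ) (hL : L ∈ T.A) (hK : K ∈ T.A),
        T.Represents (L + K)
          (SymmetricAlgebra.ι 𝕜 (HKG.holomorphicDifferentials 𝕜 F) ⟨T.diff L, hA L hL⟩ *
            SymmetricAlgebra.ι 𝕜 (HKG.holomorphicDifferentials 𝕜 F) ⟨T.diff K, hA K hK⟩)) ∧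
    ∀ (i : Fin k) (v : Fin (k + 1) → ℕ), T.nrm (T.gamma v i 0) + 4 ≤ 4 * HKG.genus 𝕜 F →
      -- each term is a holomorphic quadratic differential
      (∀ u ∈ T.terms v i, T.nrm u + 4 ≤ 4 * HKG.genus 𝕜 F ∧
        T.quadDiff u ∈ HKG.holomorphicQuadraticDifferentials 𝕜 F) ∧
      -- whatever the representatives of the terms, `G_{v,i}` is a quadratic element of the
      -- canonical ideal
      ∀ W : (Fin (k + 1) → ℕ) → HKG.SymH 𝕜 F, (∀ u ∈ T.terms v i, T.Represents u (W u)) →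
        T.G v i W ∈ HKG.Sym2H 𝕜 F ∧ T.G v i W ∈ HKG.canonicalIdeal 𝕜 F := by
  have hg := T.genus_le
  have hdiff : ∀ L ∈ T.A, T.diff L ∈ HKG.holomorphicDifferentials 𝕜 F := fun L hL => by
    have hL' : T.nrm L + 2 ≤ 2 * HKG.genus 𝕜 F := hL
    -- Membership in `𝐀` forces `g > 0`, which leaves the alternative `2g ≤ N + 1`, that is `2g - 2
    -- ≤ N - 1`. The bound `4g - 4 ≤ 2 (N - 1)` for quadratic differentials arises in the same way.
    exact HKG.Tower.diff_mem_holomorphicDifferentials (by omega)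
  refine ⟨⟨hdiff, fun L K hL hK => HKG.Tower.represents_mul L K (hdiff L hL) (hdiff K hK)⟩, ?_⟩
  intro i v hv
  refine ⟨fun u hu => ?_, fun W hW => ⟨?_, HKG.Tower.canonicalMap_G_eq_zero hW⟩⟩
  · have hle := HKG.Tower.nrm_le_of_mem_terms hu
    exact ⟨by omega, HKG.Tower.quadDiff_mem_holomorphicQuadraticDifferentials (by omega)⟩
  · have hγ : ∀ ν ≤ T.n i, W (T.gamma v i ν) ∈ HKG.Sym2H 𝕜 F := fun ν hν =>
      (hW _ (Or.inl ⟨ν, hν, rfl⟩)).1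
    refine sub_mem (add_mem (hγ 0 (Nat.zero_le _)) (sum_mem fun ν hν => ?_))
      (sum_mem fun l hl => Submodule.smul_mem _ _ (hW _ (Or.inr ⟨l, hl, rfl⟩)).1)
    exact Submodule.smul_mem _ _ (hγ ν (Finset.mem_Icc.mp hν).2)
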